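/- Let $p$ be a prime, let $\overline{\mathbf Q}_p$ be an algebraic closure of $\mathbf Q_p$ with the extended $p$-adic absolute value and valuation $v_p$, and let $\overline{\mathbf F}_p$ be its residue field. For $a\in\overline{\mathbf F}_p$ let $[a]\in\overline{\mathbf Q}_p$ be its Teichmüller representative, i.e. the unique element that reduces to $a$ and satisfies $[a]^{p^k}=[a]$ for some $k\ge 1$. Fix any choice of rational powers of $p$ in $\overline{\mathbf Q}_p$, i.e. a map $t\mapsto p^t$ from $\mathbf Q$ to $\overline{\mathbf Q}_p$ with $p^{s+t}=p^sp^t$ for all $s,t\in\mathbf Q$ and with value $p$ at $t=1$. Let $x\in\overline{\mathbf Q}_p$ with $v_p(x)\ge 0$ (where $v_p(0)=\infty$), and suppose that the degree $n$ of the minimal polynomial of $x$ over $\mathbf Q_p$ is not divisible by $p$. Then there are $N\in\{0,1,2,\dots\}\cup\{\infty\}$, a strictly increasing sequence of rational numbers $t_i=u_i/v_i$ $(0\le i<N)$ in lowest terms with $v_i\ge 1$, and nonzero elements $\varepsilon_i\in\overline{\mathbf F}_p$ $(0\le i<N)$ such that $$x=\sum_{0\le i<N}[\varepsilon_i]\,p^{t_i},$$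 where the sum, if infinite, is the $p$-adic limit of its partial sums. Moreover: (i) $\lim_{m\to\infty}\operatorname{lcm}\{v_i : i<m,\ i<N\}=e$, where $e$ is the ramification index of $\mathbf Q_p(x)$ over $\mathbf Q_p$, that is, the index of the value group of $\mathbf Q_p$ in the value group of $\mathbf Q_p(x)$ (the lcm of the empty set is $1$); and $[\varepsilon_i]^{v_i}\in\mathbf Q_p(x)$ for every $i<N$. (ii) All the $\varepsilon_i$ lie in one finite extension of $\mathbf F_p$ inside $\overline{\mathbf F}_p$. (iii) The expansion is unique: if $x=\sum_{0\le i<N'}[\varepsilon'_i]\,p^{t'_i}$ is any expansion with $N'\in\{0,1,2,\dots\}\cup\{\infty\}$, $(t'_i)$ a strictly increasing sequence of rational numbers and $\varepsilon'_i\in\overline{\mathbf F}_p$ all nonzero, then $N'=N$, and $t'_i=t_i$ and $\varepsilon'_i=\varepsilon_i$ for all $i<N$. -/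

import Mathlib

open Filter Topology Polynomial
open scoped NNReal IntermediateField

namespace PadicExpansion

section

variable (p : ℕ) [Fact p.Prime]

/-- The valuation ring `{z : |z| ≤ 1}` of the algebraic closure `PadicAlgCl p` of `ℚ_[p]`. -/
noncomputable abbrev IntRing : ValuationSubring (PadicAlgCl p) :=
  (Valued.v : Valuation (PadicAlgCl p) ℝ≥0).valuationSubring

/-- The residue field of the algebraic closure of `ℚ_[p]`. It is an algebraic closure of the field
with `p` elements, and the digits of an expansion are taken in it. -/
noncomputable abbrev Digit : Type := IsLocalRing.ResidueField (IntRing p)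

/-- `z` is the Teichmüller representative of `a`: it reduces to `a` and it satisfies
`z ^ (p ^ k) = z` for some `k ≥ 1`, that is, `z` is `0` or a root of unity of order prime
to `p`. -/
def IsTeichmuller (a : Digit p) (z : IntRing p) : Prop :=
  IsLocalRing.residue (IntRing p) z = a ∧ ∃ k : ℕ, 1 ≤ k ∧ z ^ p ^ k = z

/-- The ramification index over `ℚ_[p]` of an algebraic extension `K` of `ℚ_[p]`: the index of the
value group of `ℚ_[p]` in the value group of `K`. -/
noncomputable def ramificationIndex (K : IntermediateField ℚ_[p] (PadicAlgCl p)) : ℕ :=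
  Subgroup.relIndex
    (((Units.map (Valued.v : Valuation (PadicAlgCl p) ℝ≥0).toMonoidHom).comp
      (Units.map (algebraMap ℚ_[p] (PadicAlgCl p)).toMonoidHom)).range)
    (((Units.map (Valued.v : Valuation (PadicAlgCl p) ℝ≥0).toMonoidHom).comp
      (Units.map (algebraMap K (PadicAlgCl p)).toMonoidHom)).range)

/-- `ω` is a choice of all the rational powers of `p` in `PadicAlgCl p`: it is a homomorphism from
`(ℚ, +)` to the multiplicative group with `ω 1 = p`; one writes `p ^ t` for `ω t`. -/
structure IsPowerSystem (ω : ℚ → PadicAlgCl p) : Prop where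
  map_one : ω 1 = (p : PadicAlgCl p)
  map_add : ∀ s t : ℚ, ω (s + t) = ω s * ω t

end

section

variable {p : ℕ} [Fact p.Prime]

theorem mem_intRing {z : PadicAlgCl p} : z ∈ IntRing p ↔ ‖z‖ ≤ 1 := Iff.rfl

theorem residue_eq_zero {z : IntRing p} :
    IsLocalRing.residue (IntRing p) z = 0 ↔ ‖(z : PadicAlgCl p)‖ < 1 := by
  rw [IsLocalRing.residue_eq_zero_iff, IsLocalRing.mem_maximalIdeal, mem_nonunits_iff,
    ← not_iff_not, not_not, not_lt]
  have h := (Valuation.integer.integers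
    (Valued.v : Valuation (PadicAlgCl p) ℝ≥0)).isUnit_iff_valuation_eq_one (x := z)
  refine Iff.trans h ?_
  change ‖(z : PadicAlgCl p)‖₊ = 1 ↔ _
  rw [← NNReal.coe_inj, coe_nnnorm, NNReal.coe_one]
  exact ⟨fun h => h.ge, fun h => le_antisymm (mem_intRing.1 z.2) h⟩

theorem digit_natCast_p : ((p : ℕ) : Digit p) = 0 := by
  have hp : p.Prime := Fact.out
  have h : IsLocalRing.residue (IntRing p) (p : IntRing p) = 0 := by
    rw [residue_eq_zero]
    have h2 : ‖((p : ℚ_[p]) : PadicAlgCl p)‖ < 1 := by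
      rw [PadicAlgCl.norm_extends]
      exact Padic.norm_p_lt_one
    simpa using h2
  simpa using h

/-- Every element of the residue field is fixed by a power of Frobenius. -/
theorem digit_pow_eq (a : Digit p) : ∃ k : ℕ, 1 ≤ k ∧ a ^ p ^ k = a := by
  have hp : p.Prime := Fact.out
  obtain ⟨y, rfl⟩ := IsLocalRing.residue_surjective a
  set a := IsLocalRing.residue (IntRing p) y with ha
  have hint : IsIntegral ℚ_[p] (y : PadicAlgCl p) := Algebra.IsIntegral.isIntegral _
  have hco : ∀ n, ‖(minpoly ℚ_[p] (y : PadicAlgCl p)).coeff n‖ ≤ 1 :=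
    (spectralValue_le_one_iff (minpoly.monic hint)).1 (mem_intRing.1 y.2)
  have hl : minpoly ℚ_[p] (y : PadicAlgCl p) ∈ lifts (PadicInt.Coe.ringHom (p := p)) := by
    rw [lifts_iff_coeff_lifts]
    exact fun n => ⟨⟨_, hco n⟩, rfl⟩
  obtain ⟨Q, hQ, -, hQm⟩ := lifts_and_natDegree_eq_and_monic hl (minpoly.monic hint)
  let φ₀ : ℤ_[p] →+* PadicAlgCl p :=
    (algebraMap ℚ_[p] (PadicAlgCl p)).comp PadicInt.Coe.ringHom
  have hφ₀ : ∀ r : ℤ_[p], ‖φ₀ r‖ = ‖r‖ := fun r => PadicAlgCl.norm_extends p (r : ℚ_[p])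
  let φ : ℤ_[p] →+* IntRing p := φ₀.codRestrict (IntRing p)
    (fun r => mem_intRing.2 ((hφ₀ r).trans_le r.norm_le_one))
  have hφ : ∀ r, ((φ r : IntRing p) : PadicAlgCl p) = φ₀ r := fun r => rfl
  have h1 : eval₂ φ y Q = 0 := by
    apply Subtype.ext
    have : (IntRing p).subtype (eval₂ φ y Q) = 0 := by
      rw [hom_eval₂]
      have h2 := minpoly.aeval ℚ_[p] (y : PadicAlgCl p)
      rw [← hQ, aeval_def, eval₂_map] at h2
      exact h2
    exact this
  have h2 : eval₂ ((IsLocalRing.residue (IntRing p)).comp φ) a Q = 0 := by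
    rw [ha, ← hom_eval₂, h1, map_zero]
  have hker : ∀ r ∈ RingHom.ker (PadicInt.toZMod (p := p)),
      ((IsLocalRing.residue (IntRing p)).comp φ) r = 0 := by
    intro r hr
    rw [PadicInt.ker_toZMod, IsLocalRing.mem_maximalIdeal, PadicInt.mem_nonunits] at hr
    rw [RingHom.comp_apply, residue_eq_zero, hφ, hφ₀]
    exact hr
  let ψ : ZMod p →+* Digit p :=
    RingHom.liftOfSurjective (PadicInt.toZMod (p := p)) (ZMod.ringHom_surjective _)
      ⟨(IsLocalRing.residue (IntRing p)).comp φ, hker⟩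
  have hψ : ψ.comp (PadicInt.toZMod (p := p)) = (IsLocalRing.residue (IntRing p)).comp φ :=
    RingHom.liftOfRightInverse_comp _ _ _ _
  let := ψ.toAlgebra
  have h3 : IsIntegral (ZMod p) a := by
    refine ⟨Q.map PadicInt.toZMod, hQm.map _, ?_⟩
    rw [eval₂_map]
    change eval₂ (ψ.comp _) a Q = 0
    rw [hψ, h2]
  have : FiniteDimensional (ZMod p) (IntermediateField.adjoin (ZMod p) {a}) :=
    IntermediateField.adjoin.finiteDimensional h3
  have : Finite (IntermediateField.adjoin (ZMod p) {a}) := Module.finite_of_finite (ZMod p)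
  let := Fintype.ofFinite (IntermediateField.adjoin (ZMod p) {a})
  have : CharP (IntermediateField.adjoin (ZMod p) {a}) p :=
    charP_of_injective_algebraMap (algebraMap (ZMod p) _).injective p
  obtain ⟨n, -, hn⟩ := FiniteField.card (IntermediateField.adjoin (ZMod p) {a}) p
  refine ⟨n, n.2, ?_⟩
  have h4 := FiniteField.pow_card
    (⟨a, IntermediateField.mem_adjoin_simple_self (ZMod p) a⟩ :
      IntermediateField.adjoin (ZMod p) {a})
  rw [hn] at h4
  exact congrArg Subtype.val h4

theorem existsUnique_teichmuller (a : Digit p) : ∃! z : IntRing p, IsTeichmuller p a z := by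
  have hp : p.Prime := Fact.out
  obtain ⟨y, rfl⟩ := IsLocalRing.residue_surjective a
  refine existsUnique_of_exists_of_unique ?_ ?_
  · obtain ⟨k, hk, hak⟩ := digit_pow_eq (IsLocalRing.residue (IntRing p) y)
    have hq : 1 < p ^ k := Nat.one_lt_pow (by omega) hp.one_lt
    have hm : (X ^ p ^ k - X : (PadicAlgCl p)[X]).Monic := by
      refine monic_X_pow_sub ?_
      rw [degree_X]
      exact_mod_cast hq
    have hs := (IsAlgClosed.splits (X ^ p ^ k - X : (PadicAlgCl p)[X])).eval_eq_prod_roots_of_monic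
      hm (y : PadicAlgCl p)
    have hlt : ‖(y : PadicAlgCl p) ^ p ^ k - y‖ < 1 := by
      have := (residue_eq_zero (z := y ^ p ^ k - y)).1 (by rw [map_sub, map_pow, hak, sub_self])
      simpa using this
    have hex : ∃ z ∈ (X ^ p ^ k - X : (PadicAlgCl p)[X]).roots, ‖(y : PadicAlgCl p) - z‖ < 1 := by
      by_contra! hcon
      have h1 : 1 ≤ ‖((X ^ p ^ k - X : (PadicAlgCl p)[X]).roots.map
          (fun z => (y : PadicAlgCl p) - z)).prod‖ := by
        generalize (X ^ p ^ k - X : (PadicAlgCl p)[X]).roots = s at hcon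
        induction s using Multiset.induction_on with
        | empty => simp
        | cons z s ih =>
          rw [Multiset.map_cons, Multiset.prod_cons, norm_mul]
          exact one_le_mul_of_one_le_of_one_le (hcon z (by simp))
            (ih fun w hw => hcon w (by simp [hw]))
      rw [← hs] at h1
      simp only [eval_sub, eval_pow, eval_X] at h1
      linarith
    obtain ⟨z, hz, hyz⟩ := hex
    have hzk : z ^ p ^ k = z := by
      have := isRoot_of_mem_roots hz
      simpa [sub_eq_zero] using this
    have hz1 : ‖z‖ ≤ 1 := by
      have := PadicAlgCl.isNonarchimedean p (z - y) y
      rw [sub_add_cancel, norm_sub_rev] at this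
      exact this.trans (max_le hyz.le (mem_intRing.1 y.2))
    refine ⟨⟨z, mem_intRing.2 hz1⟩, ?_, k, hk, Subtype.ext hzk⟩
    rw [← sub_eq_zero, ← map_sub, residue_eq_zero]
    simpa [norm_sub_rev] using hyz
  · rintro z w ⟨hz, k, hk, hzk⟩ ⟨hw, l, hl, hwl⟩
    have hz' : ∀ n : ℕ, z ^ p ^ (k * n) = z := by
      intro n
      induction n with
      | zero => simp
      | succ n ih => rw [Nat.mul_succ, pow_add, pow_mul, ih, hzk]
    have hw' : ∀ n : ℕ, w ^ p ^ (l * n) = w := by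
      intro n
      induction n with
      | zero => simp
      | succ n ih => rw [Nat.mul_succ, pow_add, pow_mul, ih, hwl]
    have h1 := hz' l
    have h2 := hw' k
    rw [mul_comm l k] at h2
    set q := p ^ (k * l) with hq
    have hg := (Commute.all z w).geom_sum₂_mul q
    rw [h1, h2] at hg
    have hr : IsLocalRing.residue (IntRing p)
        (∑ i ∈ Finset.range q, z ^ i * w ^ (q - 1 - i)) = 0 := by
      rw [map_sum]
      simp only [map_mul, map_pow, hz, hw]
      rw [geom_sum₂_self, hq, Nat.cast_pow, digit_natCast_p,
        zero_pow (by positivity), zero_mul]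
    set S := ∑ i ∈ Finset.range q, z ^ i * w ^ (q - 1 - i) with hS
    have hne : S - 1 ≠ 0 := by
      intro h0
      rw [sub_eq_zero.1 h0, _root_.map_one] at hr
      exact one_ne_zero hr
    have : (S - 1) * (z - w) = 0 := by rw [sub_mul, hg, one_mul, sub_self]
    exact sub_eq_zero.1 ((mul_eq_zero.1 this).resolve_left hne)

/-- The Teichmüller representative of a digit, as an element of the algebraic closure. -/
noncomputable def teichmuller (a : Digit p) : PadicAlgCl p :=
  ((existsUnique_teichmuller a).choose : IntRing p)

theorem exists_isPowerSystem : ∃ ω : ℚ → PadicAlgCl p, IsPowerSystem p ω := by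
  have hp : p.Prime := Fact.out
  have hp0 : (p : PadicAlgCl p) ≠ 0 := Nat.cast_ne_zero.2 hp.ne_zero
  let : DivisibleBy (Additive (PadicAlgCl p)ˣ) ℕ := by
    refine divisibleByOfSMulRightSurj _ _ fun {n} hn u => ?_
    obtain ⟨z, hz⟩ := IsAlgClosed.exists_pow_nat_eq ((u.toMul : (PadicAlgCl p)ˣ) : PadicAlgCl p)
      (Nat.pos_of_ne_zero hn)
    have hz0 : z ≠ 0 := by
      rintro rfl
      rw [zero_pow hn] at hz
      exact u.toMul.ne_zero hz.symm
    exact ⟨Additive.ofMul (Units.mk0 z hz0), Units.ext hz⟩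
  let : DivisibleBy (Additive (PadicAlgCl p)ˣ) ℤ := AddGroup.divisibleByIntOfDivisibleByNat _
  obtain ⟨h, hh⟩ := (Module.Baer.of_divisible
    (Additive (PadicAlgCl p)ˣ)).extension_property_addMonoidHom (Int.castAddHom ℚ)
      Int.cast_injective (zmultiplesHom _ (Additive.ofMul (Units.mk0 (p : PadicAlgCl p) hp0)))
  refine ⟨fun t => ((h t).toMul : (PadicAlgCl p)ˣ), ?_, fun s t => ?_⟩
  · have h1 := DFunLike.congr_fun hh 1
    simp only [AddMonoidHom.comp_apply, Int.coe_castAddHom, Int.cast_one, zmultiplesHom_apply,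
      one_smul] at h1
    rw [h1]
    rfl
  · rw [_root_.map_add]
    rfl

variable (p) in
/-- `x = ∑ ε_i p ^ t_i`, where `i` runs through the natural numbers `i < N` (so that the sum is
finite or infinite), the rational exponents `t_i` are strictly increasing, and the digits `ε_i` are
nonzero; a digit stands for its Teichmüller representative. The values of `t` and `ε` at the `i`
that are not `< N` are irrelevant. -/
structure IsExpansion (ω : ℚ → PadicAlgCl p) (x : PadicAlgCl p) (N : ℕ∞) (t : ℕ → ℚ)
    (ε : ℕ → Digit p) : Prop where
  strictMono : ∀ i j : ℕ, i < j → (j : ℕ∞) < N → t i < t j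
  digit_ne_zero : ∀ i : ℕ, (i : ℕ∞) < N → ε i ≠ 0
  tendsto_sum : Tendsto
    (fun m : ℕ => ∑ i ∈ Finset.range m with ((i : ℕ) : ℕ∞) < N, teichmuller (ε i) * ω (t i)) atTop (𝓝 x)

end

end PadicExpansion

/-! ### Teichmüller representatives and absolute values -/

namespace PadicExpansion

variable {p : ℕ} [Fact p.Prime]

/-! Let `K = ℚ_p(x)`. Its value group is generated by `|p ^ (1/e)|` with `e ∣ n`, hence `p ∤ e`: the
extension is tame. Let `L` be `K` with all Teichmüller representatives adjoined. This is unramified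
over `K`, so `L` has the same value group (`exists_norm_eq_of_mem_adjoinTeichmuller`). Tameness puts
`p ^ (1/e)` itself in `L` (`IsPowerSystem.root_mem_adjoinTeichmuller`): divided by a uniformizer of
`K` and a Teichmüller representative, it becomes a principal unit whose `e`-th power lies in `L`,
and principal units have unique `e`-th roots, so Galois fixes it.

Existence: a nonzero `y ∈ L` has a leading term `[a] p ^ (i/e)`, again in `L`. Removing leading
terms repeatedly makes the exponents increase in `(1/e)ℤ`, so the remainders tend to `0`
(`IsPowerSystem.exists_isExpansion`). Uniqueness is ultrametric and needs no tameness: the size of a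
remainder gives the next exponent, its residue the next digit.

An automorphism `σ` fixing `x` carries the expansion to another one, since `σ(p ^ t) / p ^ t` is a
root of unity of order prime to `p`. Uniqueness then shows that `[ε_i] ^ v_i` is fixed, so it lies
in `K`. As `K` contains finitely many Teichmüller representatives, only finitely many digits occur.
Finally, if `l` is the lcm of all the `v_i`, then `l ∣ e`, and `x` lies in an unramified extension
of `ℚ_p(p ^ (1/l))`, whose values are powers of `|p ^ (1/l)|`; so `e ∣ l`. -/

/-- `z` is fixed by a power of `z ↦ z ^ p`: these are the Teichmüller representatives. -/
def IsTeichmullerRep (z : PadicAlgCl p) : Prop := ∃ k : ℕ, 1 ≤ k ∧ z ^ p ^ k = z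

theorem norm_sub_le_max (y z : PadicAlgCl p) : ‖y - z‖ ≤ max ‖y‖ ‖z‖ := by
  rw [sub_eq_add_neg, ← norm_neg z]
  exact PadicAlgCl.isNonarchimedean p y (-z)

theorem norm_eq_of_norm_sub_lt {y z : PadicAlgCl p} (h : ‖y - z‖ < ‖z‖) : ‖y‖ = ‖z‖ := by
  rw [← norm_neg z]
  refine IsUltrametricDist.norm_eq_of_add_norm_lt_max ?_
  rw [← sub_eq_add_neg, norm_neg]
  exact h.trans_le (le_max_right _ _)

theorem pow_pow_mul_eq_self {M : Type*} [Monoid M] {z : M} {q k : ℕ} (h : z ^ q ^ k = z) (n : ℕ) :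
    z ^ q ^ (k * n) = z := by
  induction n with
  | zero => simp
  | succ n ih => rw [Nat.mul_succ, pow_add, pow_mul, ih, h]

theorem teichmuller_mem_intRing (a : Digit p) : teichmuller a ∈ IntRing p :=
  ((existsUnique_teichmuller a).choose : IntRing p).2

theorem isTeichmuller_teichmuller (a : Digit p) :
    IsTeichmuller p a ⟨teichmuller a, teichmuller_mem_intRing a⟩ :=
  (existsUnique_teichmuller a).choose_spec.1

theorem IsTeichmuller.eq_teichmuller {a : Digit p} {z : IntRing p} (h : IsTeichmuller p a z) :
    (z : PadicAlgCl p) = teichmuller a :=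
  congrArg Subtype.val ((existsUnique_teichmuller a).choose_spec.2 z h)

theorem isTeichmullerRep_teichmuller (a : Digit p) : IsTeichmullerRep (teichmuller a) := by
  obtain ⟨-, k, hk, h⟩ := isTeichmuller_teichmuller a
  exact ⟨k, hk, congrArg Subtype.val h⟩

namespace IsTeichmullerRep

variable {z w : PadicAlgCl p}

theorem mul (hz : IsTeichmullerRep z) (hw : IsTeichmullerRep w) : IsTeichmullerRep (z * w) := by
  obtain ⟨k, hk, hz⟩ := hz
  obtain ⟨l, hl, hw⟩ := hw
  refine ⟨k * l, Nat.mul_pos hk hl, ?_⟩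
  rw [mul_pow, pow_pow_mul_eq_self hz, mul_comm k l, pow_pow_mul_eq_self hw]

theorem pow (hz : IsTeichmullerRep z) (n : ℕ) : IsTeichmullerRep (z ^ n) := by
  obtain ⟨k, hk, hz⟩ := hz
  exact ⟨k, hk, by rw [← pow_mul, mul_comm, pow_mul, hz]⟩

theorem map (hz : IsTeichmullerRep z) (σ : PadicAlgCl p →+* PadicAlgCl p) :
    IsTeichmullerRep (σ z) := by
  obtain ⟨k, hk, hz⟩ := hz
  exact ⟨k, hk, by rw [← map_pow, hz]⟩

/-- By Euler, `p ^ φ(m) ≡ 1` modulo `m`, so `φ(m)` serves as the period. -/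
theorem of_pow_eq_one {m : ℕ} (hm : ¬ p ∣ m) (h : z ^ m = 1) : IsTeichmullerRep z := by
  have hp : p.Prime := Fact.out
  have hm0 : 0 < m := Nat.pos_of_ne_zero fun h0 => hm (h0 ▸ dvd_zero p)
  refine ⟨m.totient, Nat.totient_pos.2 hm0, ?_⟩
  have hc := (Nat.modEq_iff_dvd' (Nat.one_le_pow _ _ hp.pos)).1
    (Nat.ModEq.pow_totient ((hp.coprime_iff_not_dvd).2 hm)).symm
  obtain ⟨c, hc⟩ := hc
  have : p ^ m.totient = m * c + 1 := by
    have := Nat.one_le_pow m.totient p hp.pos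
    omega
  rw [this, pow_succ, pow_mul, h, one_pow, one_mul]

theorem norm_eq_one (hz : IsTeichmullerRep z) (h0 : z ≠ 0) : ‖z‖ = 1 := by
  have hp : p.Prime := Fact.out
  obtain ⟨k, hk, hz⟩ := hz
  have hq : 1 < p ^ k := Nat.one_lt_pow (by omega) hp.one_lt
  have h1 : z ^ (p ^ k - 1) = 1 := by
    apply mul_right_cancel₀ h0
    rw [← pow_succ, Nat.sub_add_cancel hq.le, hz, one_mul]
  have h2 : ‖z‖ ^ (p ^ k - 1) = 1 := by rw [← norm_pow, h1, norm_one]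
  exact (pow_eq_one_iff_of_nonneg (norm_nonneg _) (by omega)).1 h2

theorem norm_le_one (hz : IsTeichmullerRep z) : ‖z‖ ≤ 1 := by
  rcases eq_or_ne z 0 with rfl | h
  · simp
  · exact (hz.norm_eq_one h).le

theorem eq_teichmuller (hz : IsTeichmullerRep z) :
    z = teichmuller (IsLocalRing.residue (IntRing p) ⟨z, mem_intRing.2 hz.norm_le_one⟩) := by
  obtain ⟨k, hk, hz'⟩ := id hz
  exact IsTeichmuller.eq_teichmuller (z := ⟨z, mem_intRing.2 hz.norm_le_one⟩)
    ⟨rfl, k, hk, Subtype.ext hz'⟩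

theorem eq_of_norm_sub_lt_one (hz : IsTeichmullerRep z) (hw : IsTeichmullerRep w)
    (h : ‖z - w‖ < 1) : z = w := by
  rw [hz.eq_teichmuller, hw.eq_teichmuller]
  congr 1
  rw [← sub_eq_zero, ← map_sub, residue_eq_zero]
  exact h

end IsTeichmullerRep

theorem residue_teichmuller (a : Digit p) :
    IsLocalRing.residue (IntRing p) ⟨teichmuller a, teichmuller_mem_intRing a⟩ = a :=
  (isTeichmuller_teichmuller a).1

theorem teichmuller_injective : Function.Injective (teichmuller (p := p)) := by
  intro a b h
  rw [← residue_teichmuller a, ← residue_teichmuller b]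
  congr 2

theorem teichmuller_zero : teichmuller (0 : Digit p) = 0 :=
  (IsTeichmuller.eq_teichmuller (z := 0) ⟨map_zero _, 1, le_rfl, by
    rw [zero_pow (pow_ne_zero _ (Fact.out : p.Prime).ne_zero)]⟩).symm

theorem teichmuller_ne_zero {a : Digit p} (ha : a ≠ 0) : teichmuller a ≠ 0 := by
  rw [← teichmuller_zero]
  exact teichmuller_injective.ne ha

theorem norm_teichmuller {a : Digit p} (ha : a ≠ 0) : ‖teichmuller a‖ = 1 :=
  (isTeichmullerRep_teichmuller a).norm_eq_one (teichmuller_ne_zero ha)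

theorem exists_norm_sub_teichmuller_lt_one {y : PadicAlgCl p} (hy : ‖y‖ = 1) :
    ∃ a : Digit p, a ≠ 0 ∧ ‖y - teichmuller a‖ < 1 := by
  have h : ‖y - teichmuller (IsLocalRing.residue (IntRing p) ⟨y, mem_intRing.2 hy.le⟩)‖ < 1 := by
    have := residue_eq_zero (p := p) (z := ⟨y, mem_intRing.2 hy.le⟩ -
      ⟨teichmuller (IsLocalRing.residue (IntRing p) ⟨y, mem_intRing.2 hy.le⟩),
        teichmuller_mem_intRing _⟩)
    refine this.1 ?_
    rw [map_sub, residue_teichmuller, sub_self]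
  refine ⟨_, fun h0 => ?_, h⟩
  rw [h0, teichmuller_zero, sub_zero, hy] at h
  exact lt_irrefl _ h

theorem norm_algEquiv (σ : Gal(PadicAlgCl p/ℚ_[p])) (y : PadicAlgCl p) : ‖σ y‖ = ‖y‖ :=
  (spectralNorm_eq_of_equiv σ y).symm

theorem norm_pow_natDegree_minpoly (y : PadicAlgCl p) :
    ‖y‖ ^ (minpoly ℚ_[p] y).natDegree = ‖(minpoly ℚ_[p] y).coeff 0‖ := by
  have h := spectralNorm.spectralNorm_eq_norm_coeff_zero_rpow ℚ_[p] (PadicAlgCl p) y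
  rw [PadicAlgCl.spectralNorm_eq] at h
  have hd : (minpoly ℚ_[p] y).natDegree ≠ 0 :=
    (minpoly.natDegree_pos (Algebra.IsIntegral.isIntegral y)).ne'
  rw [h, ← Real.rpow_natCast, ← Real.rpow_mul (norm_nonneg _), one_div,
    inv_mul_cancel₀ (Nat.cast_ne_zero.2 hd), Real.rpow_one]

theorem norm_pow_eq_zpow {n : ℕ} {y : PadicAlgCl p} (hy : y ≠ 0)
    (hn : (minpoly ℚ_[p] y).natDegree ∣ n) : ∃ k : ℤ, ‖y‖ ^ n = (p : ℝ) ^ (-k) := by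
  obtain ⟨m, rfl⟩ := hn
  have h0 : (minpoly ℚ_[p] y).coeff 0 ≠ 0 := minpoly.coeff_zero_ne_zero (Algebra.IsIntegral.isIntegral y) hy
  refine ⟨((minpoly ℚ_[p] y).coeff 0).valuation * m, ?_⟩
  rw [pow_mul, norm_pow_natDegree_minpoly, Padic.norm_eq_zpow_neg_valuation h0, ← neg_mul, zpow_mul,
    zpow_natCast]

theorem norm_natCast_eq_one {m : ℕ} (hm : ¬ p ∣ m) : ‖(m : PadicAlgCl p)‖ = 1 := by
  rw [← map_natCast (algebraMap ℚ_[p] (PadicAlgCl p)), PadicAlgCl.norm_extends,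
    Padic.norm_natCast_eq_one_iff]
  exact ((Fact.out : p.Prime).coprime_iff_not_dvd).2 hm

/-- A principal unit has at most one `e`-th root that is a principal unit, if `p ∤ e`. -/
theorem eq_of_pow_eq_of_norm_sub_one_lt {e : ℕ} (he : ¬ p ∣ e) {v w : PadicAlgCl p}
    (hv : ‖v - 1‖ < 1) (hw : ‖w - 1‖ < 1) (h : v ^ e = w ^ e) : v = w := by
  have hu : ∀ {u : PadicAlgCl p}, ‖u - 1‖ < 1 → ∃ hu : u ∈ IntRing p,
      IsLocalRing.residue (IntRing p) ⟨u, hu⟩ = 1 := by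
    intro u h
    have hm : u ∈ IntRing p := by
      have := add_mem (mem_intRing.2 h.le) (one_mem (IntRing p))
      rwa [sub_add_cancel] at this
    refine ⟨hm, ?_⟩
    rw [← _root_.map_one (IsLocalRing.residue (IntRing p)), ← sub_eq_zero, ← map_sub,
      residue_eq_zero]
    exact h
  obtain ⟨hvm, hv1⟩ := hu hv
  obtain ⟨hwm, hw1⟩ := hu hw
  -- In `v ^ e - w ^ e = (∑ v ^ i w ^ (e-1-i)) (v - w)` the sum reduces to `e`, which is nonzero in
  -- the residue field.
  have hg := (Commute.all (⟨v, hvm⟩ : IntRing p) ⟨w, hwm⟩).geom_sum₂_mul e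
  rw [show (⟨v, hvm⟩ : IntRing p) ^ e = ⟨w, hwm⟩ ^ e from Subtype.ext h, sub_self] at hg
  rcases mul_eq_zero.1 hg with h0 | h0
  · have h1 := congrArg (IsLocalRing.residue (IntRing p)) h0
    rw [map_sum] at h1
    simp only [map_mul, map_pow, hv1, hw1, one_pow, mul_one, Finset.sum_const, Finset.card_range,
      map_zero, nsmul_eq_mul] at h1
    have h2 : IsLocalRing.residue (IntRing p) (e : IntRing p) = 0 := by simpa using h1
    rw [residue_eq_zero] at h2
    have h3 := norm_natCast_eq_one (p := p) he
    have h4 : ‖(e : PadicAlgCl p)‖ < 1 := by simpa using h2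
    linarith
  · exact congrArg Subtype.val (sub_eq_zero.1 h0)

end PadicExpansion

/-! ### Rational powers of `p` and uniqueness of expansions -/

namespace PadicExpansion

variable {p : ℕ} [Fact p.Prime]

namespace IsPowerSystem

variable {ω : ℚ → PadicAlgCl p}

theorem map_zero (hω : IsPowerSystem p ω) : ω 0 = 1 := by
  have hp : (p : PadicAlgCl p) ≠ 0 := Nat.cast_ne_zero.2 (Fact.out : p.Prime).ne_zero
  have h := hω.map_add 1 0
  rw [add_zero, hω.map_one] at h
  exact (mul_left_cancel₀ hp ((mul_one _).trans h)).symm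

theorem ne_zero (hω : IsPowerSystem p ω) (t : ℚ) : ω t ≠ 0 := by
  intro h
  have := hω.map_add t (-t)
  rw [add_neg_cancel, hω.map_zero, h, zero_mul] at this
  exact one_ne_zero this

theorem map_nsmul (hω : IsPowerSystem p ω) (n : ℕ) (t : ℚ) : ω (n * t) = ω t ^ n := by
  induction n with
  | zero => rw [Nat.cast_zero, zero_mul, hω.map_zero, pow_zero]
  | succ n ih => rw [Nat.cast_succ, add_mul, one_mul, hω.map_add, ih, pow_succ]

theorem map_neg (hω : IsPowerSystem p ω) (t : ℚ) : ω (-t) = (ω t)⁻¹ := by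
  exact eq_inv_of_mul_eq_one_left (by rw [← hω.map_add, neg_add_cancel, hω.map_zero])

theorem map_zsmul (hω : IsPowerSystem p ω) (n : ℤ) (t : ℚ) : ω (n * t) = ω t ^ n := by
  obtain ⟨m, rfl | rfl⟩ := n.eq_nat_or_neg
  · rw [Int.cast_natCast, hω.map_nsmul, zpow_natCast]
  · rw [Int.cast_neg, Int.cast_natCast, neg_mul, hω.map_neg, hω.map_nsmul, zpow_neg, zpow_natCast]

theorem map_intCast (hω : IsPowerSystem p ω) (n : ℤ) : ω n = (p : PadicAlgCl p) ^ n := by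
  rw [← mul_one (n : ℚ), hω.map_zsmul, hω.map_one]

theorem pow_den (hω : IsPowerSystem p ω) (t : ℚ) : ω t ^ t.den = (p : PadicAlgCl p) ^ t.num := by
  rw [← hω.map_nsmul, mul_comm, Rat.mul_den_eq_num, hω.map_intCast]

theorem norm_eq (hω : IsPowerSystem p ω) (t : ℚ) : ‖ω t‖ = (p : ℝ) ^ (-t : ℝ) := by
  have hp : (0 : ℝ) < p := Nat.cast_pos.2 (Fact.out : p.Prime).pos
  have hpn : ‖(p : PadicAlgCl p)‖ = (p : ℝ)⁻¹ := by
    rw [← map_natCast (algebraMap ℚ_[p] (PadicAlgCl p)), PadicAlgCl.norm_extends, Padic.norm_p]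
  refine (pow_left_inj₀ (norm_nonneg _) (Real.rpow_nonneg hp.le _) t.den_nz).1 ?_
  rw [← norm_pow, hω.pow_den, norm_zpow, hpn, ← Real.rpow_natCast, ← Real.rpow_mul hp.le, neg_mul]
  have : (t : ℝ) * (t.den : ℝ) = (t.num : ℝ) := by exact_mod_cast Rat.mul_den_eq_num t
  rw [this, Real.rpow_neg hp.le, Real.rpow_intCast, inv_zpow]

theorem norm_lt_norm_iff (hω : IsPowerSystem p ω) {s t : ℚ} : ‖ω s‖ < ‖ω t‖ ↔ t < s := by
  have hp : (1 : ℝ) < p := Nat.one_lt_cast.2 (Fact.out : p.Prime).one_lt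
  rw [hω.norm_eq, hω.norm_eq, Real.rpow_lt_rpow_left_iff hp, neg_lt_neg_iff, Rat.cast_lt]

theorem eq_of_norm_eq (hω : IsPowerSystem p ω) {s t : ℚ} (h : ‖ω s‖ = ‖ω t‖) : s = t := by
  by_contra hne
  rcases lt_or_gt_of_ne hne with hlt | hlt
  · exact (hω.norm_lt_norm_iff.2 hlt).ne' h
  · exact (hω.norm_lt_norm_iff.2 hlt).ne h

theorem norm_pos (hω : IsPowerSystem p ω) (t : ℚ) : 0 < ‖ω t‖ := norm_pos_iff.2 (hω.ne_zero t)

/-- The leading term of an element whose absolute value is that of a power of `p`. -/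
theorem exists_leading_term (hω : IsPowerSystem p ω) {y : PadicAlgCl p} {t : ℚ}
    (h : ‖y‖ = ‖ω t‖) :
    ∃ a : Digit p, a ≠ 0 ∧ ‖y - teichmuller a * ω t‖ < ‖ω t‖ := by
  have hpos := hω.norm_pos t
  obtain ⟨a, ha, hlt⟩ := exists_norm_sub_teichmuller_lt_one (p := p) (y := y / ω t)
    (by rw [norm_div, h, div_self hpos.ne'])
  refine ⟨a, ha, ?_⟩
  have : y - teichmuller a * ω t = (y / ω t - teichmuller a) * ω t := by
    rw [sub_mul, div_mul_cancel₀ _ (hω.ne_zero t)]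
  rw [this, norm_mul]
  exact (mul_lt_iff_lt_one_left hpos).2 hlt

end IsPowerSystem

namespace IsExpansion

variable {ω : ℚ → PadicAlgCl p} {x : PadicAlgCl p} {N : ℕ∞} {t : ℕ → ℚ} {ε : ℕ → Digit p}

/-- The partial sum of the terms of index `< m` of an expansion of length `N`. -/
noncomputable def partialSum (ω : ℚ → PadicAlgCl p) (N : ℕ∞) (t : ℕ → ℚ) (ε : ℕ → Digit p)
    (m : ℕ) : PadicAlgCl p :=
  ∑ i ∈ Finset.range m with ((i : ℕ) : ℕ∞) < N, teichmuller (ε i) * ω (t i)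

theorem partialSum_succ_of_lt {m : ℕ} (hm : (m : ℕ∞) < N) :
    partialSum ω N t ε (m + 1) = partialSum ω N t ε m + teichmuller (ε m) * ω (t m) := by
  rw [partialSum, Finset.range_add_one, Finset.filter_insert, if_pos hm,
    Finset.sum_insert (by simp), add_comm, partialSum]

theorem partialSum_succ_of_le {m : ℕ} (hm : N ≤ m) :
    partialSum ω N t ε (m + 1) = partialSum ω N t ε m := by
  rw [partialSum, Finset.range_add_one, Finset.filter_insert, if_neg hm.not_gt, partialSum]

theorem partialSum_of_le {m l : ℕ} (hm : N ≤ m) (hl : m ≤ l) :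
    partialSum ω N t ε l = partialSum ω N t ε m := by
  induction l, hl using Nat.le_induction with
  | base => rfl
  | succ l hl ih =>
    rw [partialSum_succ_of_le (hm.trans (Nat.cast_le.2 hl)), ih]

theorem tendsto_partialSum (h : IsExpansion p ω x N t ε) :
    Tendsto (partialSum ω N t ε) atTop (𝓝 x) := h.tendsto_sum

theorem eq_partialSum_of_le (h : IsExpansion p ω x N t ε) {m : ℕ} (hm : N ≤ m) :
    x = partialSum ω N t ε m :=
  tendsto_nhds_unique h.tendsto_partialSum (tendsto_const_nhds.congr'
    (eventually_atTop.2 ⟨m, fun _ hl => (partialSum_of_le hm hl).symm⟩))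

theorem norm_term (h : IsExpansion p ω x N t ε) {m : ℕ} (hm : (m : ℕ∞) < N) :
    ‖teichmuller (ε m) * ω (t m)‖ = ‖ω (t m)‖ := by
  rw [norm_mul, norm_teichmuller (h.digit_ne_zero m hm), one_mul]

/-- No assumption `m < N` is needed: past the end the difference is `0`, whatever the irrelevant
value `t m` is. -/
theorem norm_partialSum_sub_le (hω : IsPowerSystem p ω) (h : IsExpansion p ω x N t ε) {m l : ℕ}
    (hl : m ≤ l) :
    ‖partialSum ω N t ε l - partialSum ω N t ε m‖ ≤ ‖ω (t m)‖ := by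
  induction l, hl using Nat.le_induction with
  | base => simp
  | succ l hl ih =>
    rcases lt_or_ge (l : ℕ∞) N with hlN | hlN
    · rw [partialSum_succ_of_lt hlN, add_sub_right_comm]
      refine (PadicAlgCl.isNonarchimedean p _ _).trans (max_le ih ?_)
      rw [h.norm_term hlN]
      rcases hl.eq_or_lt with rfl | hlt
      · exact le_rfl
      · exact (hω.norm_lt_norm_iff.2 (h.strictMono m l hlt hlN)).le
    · rwa [partialSum_succ_of_le hlN]

theorem norm_sub_partialSum_le (hω : IsPowerSystem p ω) (h : IsExpansion p ω x N t ε) (m : ℕ) :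
    ‖x - partialSum ω N t ε m‖ ≤ ‖ω (t m)‖ :=
  le_of_tendsto (h.tendsto_partialSum.sub_const _).norm
    (eventually_atTop.2 ⟨m, fun _ hl => norm_partialSum_sub_le hω h hl⟩)

theorem norm_sub_partialSum_succ_lt (hω : IsPowerSystem p ω) (h : IsExpansion p ω x N t ε) (m : ℕ) :
    ‖x - partialSum ω N t ε (m + 1)‖ < ‖ω (t m)‖ := by
  rcases lt_or_ge ((m + 1 : ℕ) : ℕ∞) N with hlt | hge
  · exact (norm_sub_partialSum_le hω h (m + 1)).trans_lt
      (hω.norm_lt_norm_iff.2 (h.strictMono m (m + 1) m.lt_succ_self hlt))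
  · rw [← h.eq_partialSum_of_le hge, sub_self, norm_zero]
    exact hω.norm_pos _

theorem norm_sub_partialSum (hω : IsPowerSystem p ω) (h : IsExpansion p ω x N t ε) {m : ℕ}
    (hm : (m : ℕ∞) < N) : ‖x - partialSum ω N t ε m‖ = ‖ω (t m)‖ := by
  have h1 := norm_sub_partialSum_succ_lt hω h m
  rw [partialSum_succ_of_lt hm, ← sub_sub] at h1
  rw [← h.norm_term hm] at h1 ⊢
  exact norm_eq_of_norm_sub_lt h1

/-- This reads the length off the partial sums, so that equal partial sums force equal lengths. -/
theorem lt_iff_partialSum_ne (hω : IsPowerSystem p ω) (h : IsExpansion p ω x N t ε) {m : ℕ} :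
    (m : ℕ∞) < N ↔ x ≠ partialSum ω N t ε m := by
  refine ⟨fun hm h0 => ?_, fun hne => lt_of_not_ge fun hle => hne (h.eq_partialSum_of_le hle)⟩
  have := norm_sub_partialSum hω h hm
  rw [← h0, sub_self, norm_zero] at this
  exact (hω.norm_pos _).ne this

/-- The common remainder has absolute value `|p ^ t|` for either exponent; afterwards, the two
digits have representatives at distance less than `1`. -/
theorem term_unique (hω : IsPowerSystem p ω) {N' : ℕ∞} {t' : ℕ → ℚ} {ε' : ℕ → Digit p}
    (h : IsExpansion p ω x N t ε) (h' : IsExpansion p ω x N' t' ε') {m : ℕ}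
    (hs : partialSum ω N t ε m = partialSum ω N' t' ε' m) (hm : (m : ℕ∞) < N)
    (hm' : (m : ℕ∞) < N') : t m = t' m ∧ ε m = ε' m := by
  have ht : t m = t' m := hω.eq_of_norm_eq (by
    rw [← norm_sub_partialSum hω h hm, ← norm_sub_partialSum hω h' hm', hs])
  refine ⟨ht, teichmuller_injective ?_⟩
  have h1 := norm_sub_partialSum_succ_lt hω h m
  have h2 := norm_sub_partialSum_succ_lt hω h' m
  rw [partialSum_succ_of_lt hm] at h1
  rw [partialSum_succ_of_lt hm', ← hs, ← ht] at h2
  refine (isTeichmullerRep_teichmuller _).eq_of_norm_sub_lt_one (isTeichmullerRep_teichmuller _) ?_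
  refine (mul_lt_iff_lt_one_left (hω.norm_pos (t m))).1 ?_
  rw [← norm_mul, sub_mul]
  have h3 := norm_sub_le_max
    (x - (partialSum ω N t ε m + teichmuller (ε' m) * ω (t m)))
    (x - (partialSum ω N t ε m + teichmuller (ε m) * ω (t m)))
  rw [sub_sub_sub_cancel_left, add_sub_add_left_eq_sub] at h3
  exact h3.trans_lt (max_lt h2 h1)

theorem partialSum_unique (hω : IsPowerSystem p ω) {N' : ℕ∞} {t' : ℕ → ℚ} {ε' : ℕ → Digit p}
    (h : IsExpansion p ω x N t ε) (h' : IsExpansion p ω x N' t' ε') (m : ℕ) :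
    partialSum ω N t ε m = partialSum ω N' t' ε' m := by
  induction m with
  | zero => rfl
  | succ m ih =>
    have hiff : (m : ℕ∞) < N ↔ (m : ℕ∞) < N' := by
      rw [lt_iff_partialSum_ne hω h, lt_iff_partialSum_ne hω h', ih]
    rcases lt_or_ge (m : ℕ∞) N with hm | hm
    · obtain ⟨ht, hε⟩ := term_unique hω h h' ih hm (hiff.1 hm)
      rw [partialSum_succ_of_lt hm, partialSum_succ_of_lt (hiff.1 hm), ih, ht, hε]
    · rw [partialSum_succ_of_le hm, partialSum_succ_of_le (not_lt.1 (hiff.not.1 hm.not_gt)), ih]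

/-- An element has at most one expansion. -/
theorem unique (hω : IsPowerSystem p ω) {N' : ℕ∞} {t' : ℕ → ℚ} {ε' : ℕ → Digit p}
    (h : IsExpansion p ω x N t ε) (h' : IsExpansion p ω x N' t' ε') :
    N' = N ∧ ∀ i : ℕ, (i : ℕ∞) < N → t' i = t i ∧ ε' i = ε i := by
  have hs := partialSum_unique hω h h'
  have hiff : ∀ m : ℕ, (m : ℕ∞) < N ↔ (m : ℕ∞) < N' := fun m => by
    rw [lt_iff_partialSum_ne hω h, lt_iff_partialSum_ne hω h', hs]
  refine ⟨ENat.eq_of_forall_natCast_le_iff fun m => ?_, fun i hi => ?_⟩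
  · cases m with
    | zero => simp
    | succ m =>
      rw [Nat.cast_succ, ENat.natCast_add_one_le_iff, ENat.natCast_add_one_le_iff, hiff m]
  exact term_unique hω h' h (hs i).symm ((hiff i).1 hi) hi

end IsExpansion
end PadicExpansion

/-! ### Adjoining Teichmüller representatives is unramified -/

namespace PadicExpansion

variable {p : ℕ} [Fact p.Prime]

/-- Galois descent for a possibly infinite extension `K`. It also stands in for completeness:
automorphisms are isometries, so it applies to limits. -/
theorem mem_of_forall_fixing {K : IntermediateField ℚ_[p] (PadicAlgCl p)} {y : PadicAlgCl p}
    (h : ∀ σ : Gal(PadicAlgCl p/ℚ_[p]), (∀ z ∈ K, σ z = z) → σ y = y) : y ∈ K := by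
  rw [← InfiniteGalois.fixedField_fixingSubgroup K]
  rw [IntermediateField.mem_fixedField_iff]
  intro σ hσ
  exact h σ fun z hz => (IntermediateField.mem_fixingSubgroup_iff K σ).1 hσ z hz

/-- A polynomial in a Teichmüller representative `ζ`, of degree less than that of `ζ` and with
largest coefficient `1`, is a unit. -/
theorem norm_aeval_eq_one {K : IntermediateField ℚ_[p] (PadicAlgCl p)} {ζ : PadicAlgCl p}
    (hζ : IsTeichmullerRep ζ) {Q : K[X]} (hd : Q.natDegree < (minpoly K ζ).natDegree)
    (hle : ∀ i, ‖(Q.coeff i : PadicAlgCl p)‖ ≤ 1) {i₀ : ℕ} (hi₀ : Q.coeff i₀ = 1) :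
    ‖aeval ζ Q‖ = 1 := by
  have hint : IsIntegral K ζ := (Algebra.IsIntegral.isIntegral (R := ℚ_[p]) ζ).tower_top
  have hl : Q.map (algebraMap K (PadicAlgCl p)) ∈ lifts (IntRing p).subtype := by
    rw [lifts_iff_coeff_lifts]
    intro i
    rw [coeff_map]
    exact ⟨⟨_, mem_intRing.2 (hle i)⟩, rfl⟩
  obtain ⟨R, hR⟩ := (mem_lifts _).1 hl
  have hev : ∀ z : IntRing p, ((eval z R : IntRing p) : PadicAlgCl p) = aeval (z : PadicAlgCl p) Q := by
    intro z
    rw [aeval_def, ← eval_map, ← hR]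
    exact (eval_map_apply (IntRing p).subtype z).symm
  set z₀ : IntRing p := ⟨ζ, mem_intRing.2 hζ.norm_le_one⟩ with hz₀
  refine le_antisymm ?_ (not_lt.1 fun hlt => ?_)
  · rw [← hev z₀]
    exact mem_intRing.1 (eval z₀ R).2
  have hconj : ∀ r : (minpoly K ζ).rootSet (PadicAlgCl p), ∃ σ : Gal(PadicAlgCl p/ℚ_[p]),
      σ ζ = r ∧ ∀ c ∈ K, σ c = c := by
    rintro ⟨r, hr⟩
    have hr' : IsConjRoot K ζ r := (isConjRoot_iff_aeval_eq_zero hint).2 (mem_rootSet.1 hr).2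
    obtain ⟨σ, hσ⟩ := isConjRoot_iff_exists_algEquiv.1 hr'.symm
    exact ⟨σ.restrictScalars ℚ_[p], hσ, fun c hc => σ.commutes ⟨c, hc⟩⟩
  have hrep : ∀ r : (minpoly K ζ).rootSet (PadicAlgCl p), IsTeichmullerRep (r : PadicAlgCl p) := by
    intro r
    obtain ⟨σ, hσ, -⟩ := hconj r
    rw [← hσ]
    exact hζ.map (σ : PadicAlgCl p →+* PadicAlgCl p)
  -- The conjugates of `ζ` are Teichmüller representatives, so their residues are distinct. If
  -- `Q(ζ)` were not a unit, the reduction of `Q` would vanish at all of them, more points than its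
  -- degree allows, although one of its coefficients is `1`.
  let f : (minpoly K ζ).rootSet (PadicAlgCl p) → Digit p := fun r =>
    IsLocalRing.residue (IntRing p) ⟨r, mem_intRing.2 (hrep r).norm_le_one⟩
  have hf : Function.Injective f := by
    intro r s hrs
    apply Subtype.ext
    rw [(hrep r).eq_teichmuller, (hrep s).eq_teichmuller]
    exact congrArg teichmuller hrs
  have hzero : R.map (IsLocalRing.residue (IntRing p)) = 0 := by
    refine eq_zero_of_natDegree_lt_card_of_eval_eq_zero _ hf (fun r => ?_) ?_
    · rw [eval_map_apply, residue_eq_zero, hev]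
      obtain ⟨σ, hσ, hK⟩ := hconj r
      have : aeval (r : PadicAlgCl p) Q = σ (aeval ζ Q) := by
        rw [← hσ, aeval_def, aeval_def]
        refine Eq.trans ?_ (hom_eval₂ Q (algebraMap K (PadicAlgCl p))
          (σ : PadicAlgCl p →+* PadicAlgCl p) ζ).symm
        congr 1
        ext c
        exact (hK c c.2).symm
      change ‖aeval (r : PadicAlgCl p) Q‖ < 1
      rw [this, norm_algEquiv]
      exact hlt
    · rw [card_rootSet_eq_natDegree (minpoly.irreducible hint).separable (IsAlgClosed.splits _)]
      refine (natDegree_map_le).trans_lt ?_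
      rwa [← natDegree_map_eq_of_injective (f := (IntRing p).subtype) Subtype.val_injective, hR,
        natDegree_map]
  have h1 := congrArg (fun P => coeff P i₀) hzero
  simp only [coeff_map, coeff_zero] at h1
  rw [residue_eq_zero] at h1
  have h2 : ((R.coeff i₀ : IntRing p) : PadicAlgCl p) = 1 := by
    have := congrArg (fun P => coeff P i₀) hR
    simp only [coeff_map, hi₀, _root_.map_one] at this
    exact this
  rw [h2, norm_one] at h1
  exact lt_irrefl _ h1

/-- Adjoining a Teichmüller representative does not enlarge the value group. -/
theorem exists_norm_eq_of_mem_adjoin_simple {K : IntermediateField ℚ_[p] (PadicAlgCl p)}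
    {ζ : PadicAlgCl p} (hζ : IsTeichmullerRep ζ) {y : PadicAlgCl p} (hy : y ∈ K⟮ζ⟯) (hy0 : y ≠ 0) :
    ∃ c ∈ K, c ≠ 0 ∧ ‖y‖ = ‖c‖ := by
  have hint : IsIntegral K ζ := (Algebra.IsIntegral.isIntegral (R := ℚ_[p]) ζ).tower_top
  rw [← IntermediateField.mem_toSubalgebra,
    IntermediateField.adjoin_simple_toSubalgebra_of_isAlgebraic hint.isAlgebraic,
    Algebra.adjoin_singleton_eq_range_aeval] at hy
  obtain ⟨P₀, rfl⟩ := hy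
  change aeval ζ P₀ ≠ 0 at hy0
  change ∃ c ∈ K, c ≠ 0 ∧ ‖aeval ζ P₀‖ = ‖c‖
  rw [← minpoly.aeval_modByMonic_minpoly] at hy0 ⊢
  set P := P₀ %ₘ minpoly K ζ with hP
  have hd : P.natDegree < (minpoly K ζ).natDegree :=
    natDegree_modByMonic_lt _ (minpoly.monic hint) (minpoly.ne_one K ζ)
  have hP0 : P ≠ 0 := by
    intro h
    rw [h, map_zero] at hy0
    exact hy0 rfl
  obtain ⟨i, hi, hmax⟩ := P.support.exists_max_image (fun j => ‖(P.coeff j : PadicAlgCl p)‖)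
    (support_nonempty.2 hP0)
  have hc : P.coeff i ≠ 0 := mem_support_iff.1 hi
  have hc' : (P.coeff i : PadicAlgCl p) ≠ 0 := by simpa using hc
  -- Dividing by a coefficient of largest absolute value gives the normalization of
  -- `norm_aeval_eq_one`; that coefficient is the witness.
  have h1 : ‖aeval ζ (C (P.coeff i)⁻¹ * P)‖ = 1 := by
    refine norm_aeval_eq_one hζ ((natDegree_C_mul_le _ _).trans_lt hd) (fun j => ?_)
      (i₀ := i) (by rw [coeff_C_mul, inv_mul_cancel₀ hc])
    rw [coeff_C_mul]
    push_cast
    rw [norm_mul, norm_inv]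
    refine inv_mul_le_one_of_le₀ ?_ (norm_nonneg _)
    by_cases hj : j ∈ P.support
    · exact hmax j hj
    · rw [notMem_support_iff.1 hj]
      simp
  refine ⟨P.coeff i, (P.coeff i).2, hc', ?_⟩
  rw [map_mul, aeval_C, norm_mul] at h1
  have h2 : ‖algebraMap K (PadicAlgCl p) (P.coeff i)⁻¹‖ = ‖(P.coeff i : PadicAlgCl p)‖⁻¹ := by
    rw [map_inv₀, norm_inv]
    rfl
  rw [h2, inv_mul_eq_one₀ (norm_ne_zero_iff.2 hc')] at h1
  exact h1.symm

theorem exists_common_period (S : Finset (PadicAlgCl p)) (hS : ∀ z ∈ S, IsTeichmullerRep z) :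
    ∃ k : ℕ, 1 ≤ k ∧ ∀ z ∈ S, z ^ p ^ k = z := by
  classical
  induction S using Finset.induction_on with
  | empty => exact ⟨1, le_rfl, by simp⟩
  | insert z S hz ih =>
    obtain ⟨k, hk, h⟩ := ih fun w hw => hS w (Finset.mem_insert_of_mem hw)
    obtain ⟨l, hl, h'⟩ := hS z (Finset.mem_insert_self z S)
    refine ⟨k * l, Nat.mul_pos hk hl, fun w hw => ?_⟩
    rcases Finset.mem_insert.1 hw with rfl | hw
    · rw [mul_comm]
      exact pow_pow_mul_eq_self h' k
    · exact pow_pow_mul_eq_self (h w hw) l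

/-- With a common period `k`, the nonzero members are roots of unity of order dividing `p ^ k - 1`,
a cyclic group. This reduces finitely many adjunctions to one. -/
theorem exists_generator (S : Finset (PadicAlgCl p)) (hS : ∀ z ∈ S, IsTeichmullerRep z) :
    ∃ ζ : PadicAlgCl p, IsTeichmullerRep ζ ∧ ∀ z ∈ S, z = 0 ∨ ∃ n : ℕ, z = ζ ^ n := by
  obtain ⟨k, hk, h⟩ := exists_common_period S hS
  have hq : 1 < p ^ k := Nat.one_lt_pow (by omega) (Fact.out : p.Prime).one_lt
  have : NeZero (p ^ k - 1) := ⟨by omega⟩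
  obtain ⟨ζ, hζ⟩ := HasEnoughRootsOfUnity.exists_primitiveRoot (PadicAlgCl p) (p ^ k - 1)
  have key : ∀ z : PadicAlgCl p, z ^ p ^ k = z ^ (p ^ k - 1) * z := fun z => by
    rw [← pow_succ, Nat.sub_add_cancel hq.le]
  refine ⟨ζ, ⟨k, hk, by rw [key, hζ.pow_eq_one, one_mul]⟩, fun z hz => or_iff_not_imp_left.2
    fun hz0 => ?_⟩
  have h1 : z ^ (p ^ k - 1) = 1 := mul_right_cancel₀ hz0 (by rw [← key, h z hz, one_mul])
  obtain ⟨n, -, hn⟩ := hζ.eq_pow_of_pow_eq_one h1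
  exact ⟨n, hn.symm⟩

/-- The field obtained from `K` by adjoining all Teichmüller representatives. -/
noncomputable def adjoinTeichmuller (K : IntermediateField ℚ_[p] (PadicAlgCl p)) :
    IntermediateField ℚ_[p] (PadicAlgCl p) :=
  (IntermediateField.adjoin K {z : PadicAlgCl p | IsTeichmullerRep z}).restrictScalars ℚ_[p]

theorem le_adjoinTeichmuller (K : IntermediateField ℚ_[p] (PadicAlgCl p)) :
    K ≤ adjoinTeichmuller K :=
  fun c hc => (IntermediateField.adjoin K {z : PadicAlgCl p | IsTeichmullerRep z}).algebraMap_mem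
    ⟨c, hc⟩

theorem IsTeichmullerRep.mem_adjoinTeichmuller {z : PadicAlgCl p} (hz : IsTeichmullerRep z)
    (K : IntermediateField ℚ_[p] (PadicAlgCl p)) : z ∈ adjoinTeichmuller K :=
  IntermediateField.subset_adjoin K {z : PadicAlgCl p | IsTeichmullerRep z} hz

theorem exists_norm_eq_of_mem_adjoinTeichmuller {K : IntermediateField ℚ_[p] (PadicAlgCl p)}
    {y : PadicAlgCl p} (hy : y ∈ adjoinTeichmuller K) (hy0 : y ≠ 0) :
    ∃ c ∈ K, c ≠ 0 ∧ ‖y‖ = ‖c‖ := by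
  obtain ⟨S, hS, hyS⟩ := IntermediateField.exists_finset_of_mem_adjoin
    (show y ∈ IntermediateField.adjoin K {z : PadicAlgCl p | IsTeichmullerRep z} from hy)
  obtain ⟨ζ, hζ, h⟩ := exists_generator S hS
  refine exists_norm_eq_of_mem_adjoin_simple hζ (IntermediateField.adjoin_le_iff.2 ?_ hyS) hy0
  intro z hz
  rcases h z hz with rfl | ⟨n, rfl⟩
  · exact zero_mem _
  · exact pow_mem (IntermediateField.mem_adjoin_simple_self K ζ) n

end PadicExpansion

/-! ### Value groups, ramification index and the tame root `p ^ (1/e)` -/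

namespace PadicExpansion

variable {p : ℕ} [Fact p.Prime] {ω : ℚ → PadicAlgCl p}

theorem IsPowerSystem.norm_intCast (hω : IsPowerSystem p ω) (k : ℤ) :
    ‖ω k‖ = (p : ℝ) ^ (-k) := by
  have hp : (0 : ℝ) < p := Nat.cast_pos.2 (Fact.out : p.Prime).pos
  rw [hω.norm_eq, ← Real.rpow_intCast]
  push_cast
  rfl

theorem IsPowerSystem.norm_pow_div (hω : IsPowerSystem p ω) {n : ℕ} (hn : n ≠ 0) (r : ℚ) :
    ‖ω (r / n)‖ ^ n = ‖ω r‖ := by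
  rw [← norm_pow, ← hω.map_nsmul, mul_div_cancel₀ _ (Nat.cast_ne_zero.2 hn)]

theorem IsPowerSystem.exists_norm_eq_of_mem (hω : IsPowerSystem p ω)
    {K : IntermediateField ℚ_[p] (PadicAlgCl p)} [FiniteDimensional ℚ_[p] K] {y : PadicAlgCl p}
    (hy : y ∈ K) (hy0 : y ≠ 0) : ∃ i : ℤ, ‖y‖ = ‖ω (i / Module.finrank ℚ_[p] K)‖ := by
  have hd : (minpoly ℚ_[p] y).natDegree ∣ Module.finrank ℚ_[p] K := by
    have := minpoly.degree_dvd (K := ℚ_[p]) (x := (⟨y, hy⟩ : K))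
      (Algebra.IsIntegral.isIntegral _)
    rwa [← minpoly.algebraMap_eq (algebraMap K (PadicAlgCl p)).injective] at this
  obtain ⟨k, hk⟩ := norm_pow_eq_zpow hy0 hd
  refine ⟨k, ?_⟩
  have hn : Module.finrank ℚ_[p] K ≠ 0 := Module.finrank_pos.ne'
  refine (pow_left_inj₀ (norm_nonneg _) (norm_nonneg _) hn).1 ?_
  rw [hk, hω.norm_pow_div hn, hω.norm_intCast]

/-- The value group of a finite extension is generated by some `|p ^ (1 / e)|`. -/
theorem IsPowerSystem.exists_uniformizer (hω : IsPowerSystem p ω)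
    (K : IntermediateField ℚ_[p] (PadicAlgCl p)) [FiniteDimensional ℚ_[p] K] :
    ∃ e : ℕ, e ≠ 0 ∧ e ∣ Module.finrank ℚ_[p] K ∧
      (∀ y ∈ K, y ≠ 0 → ∃ i : ℤ, ‖y‖ = ‖ω (i / e)‖) ∧ ∃ π ∈ K, ‖π‖ = ‖ω (1 / e)‖ := by
  set n := Module.finrank ℚ_[p] K with hn
  have hn0 : n ≠ 0 := Module.finrank_pos.ne'
  have hnQ : (n : ℚ) ≠ 0 := Nat.cast_ne_zero.2 hn0
  -- `G` is the value group in units of `1/n`. It is some `gℤ` and contains `n`, the valuation of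
  -- `p`; hence `e = n / g`.
  let G : AddSubgroup ℤ :=
    { carrier := {i | ∃ y ∈ K, ‖y‖ = ‖ω (i / n)‖}
      zero_mem' := ⟨1, one_mem K, by simp [hω.map_zero]⟩
      add_mem' := by
        rintro i j ⟨y, hy, hyi⟩ ⟨z, hz, hzj⟩
        exact ⟨y * z, mul_mem hy hz, by
          rw [norm_mul, hyi, hzj, ← norm_mul, ← hω.map_add, ← add_div, Int.cast_add]⟩
      neg_mem' := by
        rintro i ⟨y, hy, hyi⟩
        exact ⟨y⁻¹, inv_mem hy, by
          rw [norm_inv, hyi, ← norm_inv, ← hω.map_neg, Int.cast_neg, neg_div]⟩ }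
  obtain ⟨g₀, hg₀⟩ := Int.subgroup_cyclic G
  rw [← AddSubgroup.zmultiples_eq_closure, ← Int.zmultiples_natAbs] at hg₀
  set g := g₀.natAbs
  have hnG : (n : ℤ) ∈ G := ⟨p, natCast_mem K p, by
    rw [Int.cast_natCast, div_self hnQ, hω.map_one]⟩
  have hgn : g ∣ n := by
    rw [hg₀, Int.mem_zmultiples_iff] at hnG
    exact_mod_cast hnG
  obtain ⟨e, he⟩ := hgn
  have he0 : e ≠ 0 := by
    rintro rfl
    exact hn0 he
  have hg0 : g ≠ 0 := by
    intro h
    rw [h, zero_mul] at he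
    exact hn0 he
  have hdiv : ∀ c : ℚ, g * c / n = c / e := fun c => by
    rw [he, Nat.cast_mul, mul_div_mul_left _ _ (Nat.cast_ne_zero.2 hg0)]
  refine ⟨e, he0, ⟨g, by rw [he, mul_comm]⟩, fun y hy hy0 => ?_, ?_⟩
  · obtain ⟨i, hi⟩ := hω.exists_norm_eq_of_mem hy hy0
    have hiG : i ∈ G := ⟨y, hy, hi⟩
    rw [hg₀, Int.mem_zmultiples_iff] at hiG
    obtain ⟨j, rfl⟩ := hiG
    refine ⟨j, ?_⟩
    rw [hi, ← hn, Int.cast_mul, Int.cast_natCast, hdiv]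
  · have hgG : (g : ℤ) ∈ G := by
      rw [hg₀]
      exact AddSubgroup.mem_zmultiples _
    obtain ⟨π, hπ, h⟩ := hgG
    refine ⟨π, hπ, ?_⟩
    rw [h, Int.cast_natCast, ← hdiv 1, mul_one]

/-- The map `m ↦ |π| ^ m` sends `ℤ` onto the value group of `K`, and the value group of `ℚ_p` pulls
back to `eℤ`. -/
theorem IsPowerSystem.ramificationIndex_eq (hω : IsPowerSystem p ω)
    {K : IntermediateField ℚ_[p] (PadicAlgCl p)} {e : ℕ} (he : e ≠ 0)
    (hK : ∀ y ∈ K, y ≠ 0 → ∃ i : ℤ, ‖y‖ = ‖ω (i / e)‖) {π : PadicAlgCl p} (hπ : π ∈ K)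
    (hπe : ‖π‖ = ‖ω (1 / e)‖) : ramificationIndex p K = e := by
  have heQ : (e : ℚ) ≠ 0 := Nat.cast_ne_zero.2 he
  have hπ0 : π ≠ 0 := norm_pos_iff.1 (hπe ▸ hω.norm_pos _)
  have hpow : ∀ m : ℤ, ‖π‖ ^ m = ‖ω (m / e)‖ := fun m => by
    rw [hπe, ← norm_zpow, ← hω.map_zsmul, mul_one_div]
  let u : Kˣ := Units.mk0 ⟨π, hπ⟩ (fun h => hπ0 (congrArg Subtype.val h))
  let vK : Kˣ →* ℝ≥0ˣ := (Units.map (Valued.v : Valuation (PadicAlgCl p) ℝ≥0).toMonoidHom).comp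
      (Units.map (algebraMap K (PadicAlgCl p)).toMonoidHom)
  let vQ : ℚ_[p]ˣ →* ℝ≥0ˣ := (Units.map (Valued.v : Valuation (PadicAlgCl p) ℝ≥0).toMonoidHom).comp
      (Units.map (algebraMap ℚ_[p] (PadicAlgCl p)).toMonoidHom)
  have hvK : ∀ a : Kˣ, (((vK a : ℝ≥0ˣ) : ℝ≥0) : ℝ) = ‖((a : K) : PadicAlgCl p)‖ := fun a => rfl
  have hvQ : ∀ a : ℚ_[p]ˣ, (((vQ a : ℝ≥0ˣ) : ℝ≥0) : ℝ) = ‖(a : ℚ_[p])‖ := fun a =>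
    PadicAlgCl.norm_extends p a
  have hext : ∀ {a b : ℝ≥0ˣ}, ((a : ℝ≥0) : ℝ) = ((b : ℝ≥0) : ℝ) → a = b := fun h =>
    Units.ext (NNReal.coe_injective h)
  let f : Multiplicative ℤ →* ℝ≥0ˣ := zpowersHom _ (vK u)
  have hf : ∀ m : ℤ, (((f (Multiplicative.ofAdd m) : ℝ≥0ˣ) : ℝ≥0) : ℝ) = ‖ω (m / e)‖ := by
    intro m
    rw [← hpow, zpowersHom_apply, toAdd_ofAdd, Units.val_zpow_eq_zpow_val, NNReal.coe_zpow, hvK]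
    rfl
  have hrange : f.range = vK.range := by
    refine le_antisymm ?_ ?_
    · rintro _ ⟨m, rfl⟩
      exact ⟨u ^ m.toAdd, by rw [map_zpow]; rfl⟩
    · rintro _ ⟨a, rfl⟩
      obtain ⟨i, hi⟩ := hK a (a : K).2 (by simp)
      exact ⟨Multiplicative.ofAdd i, hext (by rw [hf, hvK, hi])⟩
  have hcomap : vQ.range.comap f = AddSubgroup.toSubgroup (AddSubgroup.zmultiples (e : ℤ)) := by
    ext m
    change (∃ a, vQ a = f (Multiplicative.ofAdd m.toAdd)) ↔ m.toAdd ∈ AddSubgroup.zmultiples (e : ℤ)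
    rw [Int.mem_zmultiples_iff]
    constructor
    · rintro ⟨a, ha⟩
      have h1 := congrArg (fun c : ℝ≥0ˣ => ((c : ℝ≥0) : ℝ)) ha
      simp only [hf, hvQ] at h1
      rw [Padic.norm_eq_zpow_neg_valuation a.ne_zero, ← hω.norm_intCast] at h1
      have h2 := hω.eq_of_norm_eq h1
      rw [eq_div_iff heQ] at h2
      exact ⟨(a : ℚ_[p]).valuation, by rw [mul_comm]; exact_mod_cast h2.symm⟩
    · rintro ⟨k, hk⟩
      have hp : (p : ℚ_[p]) ≠ 0 := Nat.cast_ne_zero.2 (Fact.out : p.Prime).ne_zero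
      refine ⟨Units.mk0 ((p : ℚ_[p]) ^ k) (zpow_ne_zero _ hp), hext ?_⟩
      rw [hf, hvQ, hk, Int.cast_mul, Int.cast_natCast, mul_div_cancel_left₀ _ heQ, Units.val_mk0,
        Padic.norm_p_zpow, hω.norm_intCast]
  change vQ.range.relIndex vK.range = e
  rw [← hrange, ← Subgroup.index_comap, hcomap, AddSubgroup.index_toSubgroup, Int.index_zmultiples,
    Int.natAbs_natCast]

/-- The field `ℚ_p (p ^ (1 / e))` has its values in the group generated by `|p ^ (1 / e)|`. -/
theorem IsPowerSystem.exists_norm_eq_of_mem_adjoin (hω : IsPowerSystem p ω) {e : ℕ} (he : e ≠ 0)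
    {y : PadicAlgCl p} (hy : y ∈ ℚ_[p]⟮ω (1 / e)⟯) (hy0 : y ≠ 0) :
    ∃ i : ℤ, ‖y‖ = ‖ω (i / e)‖ := by
  have heQ : (e : ℚ) ≠ 0 := Nat.cast_ne_zero.2 he
  have hint : IsIntegral ℚ_[p] (ω (1 / e)) := Algebra.IsIntegral.isIntegral _
  have : FiniteDimensional ℚ_[p] ℚ_[p]⟮ω (1 / e)⟯ := IntermediateField.adjoin.finiteDimensional hint
  -- The degree `d` is at most `e` because of `X ^ e - p`, while the value `1/e` must lie in
  -- `(1/d)ℤ`, so `e ∣ d`. Thus `d = e`.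
  have hle : Module.finrank ℚ_[p] ℚ_[p]⟮ω (1 / e)⟯ ≤ e := by
    rw [IntermediateField.adjoin.finrank hint]
    refine (natDegree_le_of_dvd (q := X ^ e - C (p : ℚ_[p])) (minpoly.dvd _ _ ?_)
      (X_pow_sub_C_ne_zero (Nat.pos_of_ne_zero he) _)).trans_eq natDegree_X_pow_sub_C
    rw [map_sub, map_pow, aeval_X, aeval_C, ← hω.map_nsmul, mul_one_div_cancel heQ, hω.map_one,
      map_natCast, sub_self]
  set d := Module.finrank ℚ_[p] ℚ_[p]⟮ω (1 / e)⟯ with hd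
  have hd0 : d ≠ 0 := Module.finrank_pos.ne'
  obtain ⟨i, hi⟩ := hω.exists_norm_eq_of_mem
    (IntermediateField.mem_adjoin_simple_self ℚ_[p] (ω (1 / e))) (hω.ne_zero _)
  have h1 := hω.eq_of_norm_eq hi
  rw [← hd, div_eq_div_iff heQ (Nat.cast_ne_zero.2 hd0), one_mul] at h1
  have h2 : (e : ℤ) ∣ d := ⟨i, by rw [mul_comm]; exact_mod_cast h1⟩
  have h3 : d = e := hle.antisymm (Nat.le_of_dvd (Nat.pos_of_ne_zero hd0) (Int.natCast_dvd_natCast.1 h2))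
  rw [← h3]
  exact hω.exists_norm_eq_of_mem hy hy0

/-- `p ^ (1 / e)` lies in every tame extension whose value group contains its absolute value, up to
Teichmüller representatives. -/
theorem IsPowerSystem.root_mem_adjoinTeichmuller (hω : IsPowerSystem p ω) {e : ℕ} (he : ¬ p ∣ e)
    {K : IntermediateField ℚ_[p] (PadicAlgCl p)} {π : PadicAlgCl p} (hπ : π ∈ K)
    (hπe : ‖π‖ = ‖ω (1 / e)‖) : ω (1 / e) ∈ adjoinTeichmuller K := by
  have he0 : (e : ℚ) ≠ 0 := Nat.cast_ne_zero.2 fun h => he (h ▸ dvd_zero p)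
  have hπ0 : π ≠ 0 := norm_pos_iff.1 (hπe ▸ hω.norm_pos _)
  obtain ⟨a, ha, hlt⟩ := exists_norm_sub_teichmuller_lt_one (p := p) (y := ω (1 / e) / π)
    (by rw [norm_div, hπe, div_self (hω.norm_pos _).ne'])
  have hz0 := teichmuller_ne_zero ha
  set z := teichmuller a with hz
  have hzL : z ∈ adjoinTeichmuller K := (isTeichmullerRep_teichmuller a).mem_adjoinTeichmuller K
  have hπL : π ∈ adjoinTeichmuller K := le_adjoinTeichmuller K hπ
  set v := ω (1 / e) / π / z with hv
  have hv1 : ‖v - 1‖ < 1 := by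
    rw [hv, ← div_self hz0, ← sub_div, norm_div, norm_teichmuller ha, div_one]
    exact hlt
  have hve : v ^ e ∈ adjoinTeichmuller K := by
    rw [hv, div_pow, div_pow, ← hω.map_nsmul, mul_one_div_cancel he0, hω.map_one]
    exact div_mem (div_mem (natCast_mem _ p) (pow_mem hπL e)) (pow_mem hzL e)
  have hvL : v ∈ adjoinTeichmuller K := by
    -- `v` and `σ v` are principal units with the same `e`-th power, hence equal.
    refine mem_of_forall_fixing fun σ hσ => ?_
    refine eq_of_pow_eq_of_norm_sub_one_lt he ?_ hv1 ?_
    · rw [← _root_.map_one σ, ← map_sub, norm_algEquiv]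
      exact hv1
    · rw [← map_pow, hσ _ hve]
  have : ω (1 / e) = v * z * π := by
    rw [hv, div_mul_cancel₀ _ hz0, div_mul_cancel₀ _ hπ0]
  rw [this]
  exact mul_mem (mul_mem hvL hzL) hπL

end PadicExpansion

/-! ### Existence of expansions -/

namespace PadicExpansion

variable {p : ℕ} [Fact p.Prime] {ω : ℚ → PadicAlgCl p}

theorem exists_enat_lt_iff {P : ℕ → Prop} (hP : ∀ m, P (m + 1) → P m) :
    ∃ N : ℕ∞, ∀ m : ℕ, (m : ℕ∞) < N ↔ P m := by
  classical
  by_cases h : ∀ m, P m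
  · exact ⟨⊤, fun m => ⟨fun _ => h m, fun _ => ENat.natCast_lt_top m⟩⟩
  · push Not at h
    refine ⟨Nat.find h, fun m => ?_⟩
    rw [Nat.cast_lt]
    refine ⟨fun hm => not_not.1 (Nat.find_min h hm), fun hm => not_le.1 fun hle => ?_⟩
    exact Nat.find_spec h (Nat.decreasingInduction (motive := fun k _ => P k)
      (fun k _ => hP k) hm hle)

/-- Expansions exist in a field that contains `p ^ (1 / e)` and the Teichmüller representatives and
has its values in the group generated by `|p ^ (1 / e)|`. -/
theorem IsPowerSystem.exists_isExpansion (hω : IsPowerSystem p ω) {e : ℕ} (he : e ≠ 0)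
    {L : IntermediateField ℚ_[p] (PadicAlgCl p)}
    (hL : ∀ y ∈ L, y ≠ 0 → ∃ i : ℤ, ‖y‖ = ‖ω (i / e)‖) (hroot : ω (1 / e) ∈ L)
    (hT : ∀ a, teichmuller a ∈ L) {x : PadicAlgCl p} (hx : x ∈ L) :
    ∃ (N : ℕ∞) (t : ℕ → ℚ) (ε : ℕ → Digit p), IsExpansion p ω x N t ε ∧
      ∀ i : ℕ, (i : ℕ∞) < N → ∃ j : ℤ, t i = j / e := by
  classical
  have heQ : (0 : ℚ) < e := Nat.cast_pos.2 (Nat.pos_of_ne_zero he)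
  have hωL : ∀ i : ℤ, ω (i / e) ∈ L := fun i => by
    rw [div_eq_mul_one_div, hω.map_zsmul]
    exact zpow_mem hroot i
  have hstep : ∀ y : L, ∃ (i : ℤ) (a : Digit p), (y : PadicAlgCl p) ≠ 0 → a ≠ 0 ∧
      ‖(y : PadicAlgCl p)‖ = ‖ω (i / e)‖ ∧ ‖(y : PadicAlgCl p) - teichmuller a * ω (i / e)‖ < ‖ω (i / e)‖ := by
    intro y
    by_cases h0 : (y : PadicAlgCl p) = 0
    · exact ⟨0, 0, fun h => absurd h0 h⟩
    · obtain ⟨i, hi⟩ := hL y y.2 h0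
      obtain ⟨a, ha, hlt⟩ := hω.exists_leading_term hi
      exact ⟨i, a, fun _ => ⟨ha, hi, hlt⟩⟩
  choose I A hIA using hstep
  -- One step removes the leading term; `0` is kept fixed, so the iteration is total and `N` is the
  -- first index with zero remainder.
  let next : L → L := fun y => if (y : PadicAlgCl p) = 0 then y else
    y - ⟨teichmuller (A y) * ω (I y / e), mul_mem (hT _) (hωL _)⟩
  let r : ℕ → L := fun m => next^[m] ⟨x, hx⟩
  have hr : ∀ m, r (m + 1) = next (r m) := fun m => Function.iterate_succ_apply' next m _
  have hr0 : ∀ m, (r m : PadicAlgCl p) = 0 → (r (m + 1) : PadicAlgCl p) = 0 := fun m h => by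
    rw [hr]
    simp only [next, if_pos h]
    exact h
  have hr1 : ∀ m, (r m : PadicAlgCl p) ≠ 0 →
      (r (m + 1) : PadicAlgCl p) = r m - teichmuller (A (r m)) * ω (I (r m) / e) := fun m h => by
    rw [hr]
    simp only [next, if_neg h]
    rfl
  have hIlt : ∀ m, (r (m + 1) : PadicAlgCl p) ≠ 0 → I (r m) < I (r (m + 1)) := by
    intro m h
    have h0 := fun h' => h (hr0 m h')
    have h1 := (hIA (r m) h0).2.2
    rw [← hr1 m h0, (hIA (r (m + 1)) h).2.1, hω.norm_lt_norm_iff,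
      div_lt_div_iff_of_pos_right heQ, Int.cast_lt] at h1
    exact h1
  obtain ⟨N, hN⟩ := exists_enat_lt_iff (P := fun m => (r m : PadicAlgCl p) ≠ 0)
    fun m h h' => h (hr0 m h')
  have hsum : ∀ m, IsExpansion.partialSum ω N (fun i => I (r i) / e) (fun i => A (r i)) m =
      x - r m := by
    intro m
    induction m with
    | zero => exact (sub_self x).symm
    | succ m ih =>
      by_cases h : (r m : PadicAlgCl p) = 0
      · rw [IsExpansion.partialSum_succ_of_le (not_lt.1 fun hlt => (hN m).1 hlt h), ih, h, hr0 m h]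
      · rw [IsExpansion.partialSum_succ_of_lt ((hN m).2 h), ih, hr1 m h]
        ring
  -- The integers `I (r m)` grow by at least `1` per step, so the remainders decay geometrically
  -- with ratio `|p ^ (1/e)|`.
  have hbound : ∀ m, ‖(r m : PadicAlgCl p)‖ ≤ ‖ω (I (r 0) / e)‖ * ‖ω (1 / e)‖ ^ m := by
    intro m
    have h1 : (r m : PadicAlgCl p) ≠ 0 → I (r 0) + m ≤ I (r m) := by
      induction m with
      | zero => simp
      | succ m ih =>
        intro h
        have := ih fun h' => h (hr0 m h')
        have := hIlt m h
        push_cast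
        omega
    by_cases h : (r m : PadicAlgCl p) = 0
    · rw [h, norm_zero]
      positivity
    · rw [← norm_pow, ← norm_mul, ← hω.map_nsmul, ← hω.map_add, (hIA (r m) h).2.1, mul_one_div,
        ← add_div, ← not_lt, hω.norm_lt_norm_iff, div_lt_div_iff_of_pos_right heQ, not_lt]
      exact_mod_cast h1 h
  have hlt1 : ‖ω (1 / e)‖ < 1 := by
    rw [← norm_one (α := PadicAlgCl p), ← hω.map_zero, hω.norm_lt_norm_iff]
    positivity
  have hlim : Tendsto (fun m => (r m : PadicAlgCl p)) atTop (𝓝 0) := by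
    refine squeeze_zero_norm hbound ?_
    rw [← mul_zero ‖ω (I (r 0) / e)‖]
    exact (tendsto_pow_atTop_nhds_zero_of_lt_one (norm_nonneg _) hlt1).const_mul _
  refine ⟨N, fun i => I (r i) / e, fun i => A (r i), ⟨fun i j hij hj => ?_, fun i hi => ?_, ?_⟩,
    fun i _ => ⟨I (r i), rfl⟩⟩
  · have hj' := (hN j).1 hj
    have key : ∀ k, i + 1 ≤ k → (r k : PadicAlgCl p) ≠ 0 → I (r i) < I (r k) := by
      intro k hk
      induction k, hk using Nat.le_induction with
      | base => exact hIlt i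
      | succ k _ ih => exact fun h => (ih fun h' => h (hr0 k h')).trans (hIlt k h)
    exact div_lt_div_of_pos_right (Int.cast_lt.2 (key j hij hj')) heQ
  · exact (hIA (r i) ((hN i).1 hi)).1
  · change Tendsto (IsExpansion.partialSum ω N (fun i => I (r i) / e) (fun i => A (r i))) atTop (𝓝 x)
    have h := hlim.const_sub x
    rw [sub_zero] at h
    exact h.congr fun m => (hsum m).symm

/-! ### Galois action on expansions -/

theorem continuous_algEquiv (σ : Gal(PadicAlgCl p/ℚ_[p])) : Continuous σ :=
  (AddMonoidHomClass.isometry_of_norm σ (norm_algEquiv σ)).continuous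

namespace IsExpansion

variable {x : PadicAlgCl p} {N : ℕ∞} {t : ℕ → ℚ} {ε : ℕ → Digit p}

/-- For `σ` fixing `x`, uniqueness gives `[ε_i] = σ[ε_i] · σ(p ^ t_i) / p ^ t_i`. The last quotient
is a `v_i`-th root of unity and disappears in the `v_i`-th power. -/
theorem teichmuller_pow_den_mem (hω : IsPowerSystem p ω) (h : IsExpansion p ω x N t ε)
    (hden : ∀ i : ℕ, (i : ℕ∞) < N → ¬ p ∣ (t i).den) {i : ℕ} (hi : (i : ℕ∞) < N) :
    teichmuller (ε i) ^ (t i).den ∈ ℚ_[p]⟮x⟯ := by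
  refine mem_of_forall_fixing fun σ hσ => ?_
  have hσx : σ x = x := hσ x (IntermediateField.mem_adjoin_simple_self ℚ_[p] x)
  have hroot : ∀ j, (σ (ω (t j)) / ω (t j)) ^ (t j).den = 1 := fun j => by
    rw [div_pow, ← map_pow, hω.pow_den, map_zpow₀, map_natCast, div_self]
    exact zpow_ne_zero _ (Nat.cast_ne_zero.2 (Fact.out : p.Prime).ne_zero)
  have hex : ∀ j : ℕ, ∃ a : Digit p, (j : ℕ∞) < N →
      teichmuller a = σ (teichmuller (ε j)) * (σ (ω (t j)) / ω (t j)) := by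
    intro j
    by_cases hj : (j : ℕ∞) < N
    · exact ⟨_, fun _ => (((isTeichmullerRep_teichmuller (ε j)).map
        (σ : PadicAlgCl p →+* PadicAlgCl p)).mul
          (IsTeichmullerRep.of_pow_eq_one (hden j hj) (hroot j))).eq_teichmuller.symm⟩
    · exact ⟨0, fun h => absurd h hj⟩
  choose ε' hε' using hex
  have h' : IsExpansion p ω x N t ε' := by
    refine ⟨h.strictMono, fun j hj h0 => ?_, ?_⟩
    · have h1 := hε' j hj
      rw [h0, teichmuller_zero] at h1
      refine mul_ne_zero ?_ (div_ne_zero ?_ (hω.ne_zero _)) h1.symm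
      · exact (map_ne_zero σ).2 (teichmuller_ne_zero (h.digit_ne_zero j hj))
      · exact (map_ne_zero σ).2 (hω.ne_zero _)
    · have h1 := ((continuous_algEquiv σ).tendsto x).comp h.tendsto_sum
      rw [hσx] at h1
      refine h1.congr fun m => ?_
      rw [Function.comp_apply, map_sum]
      refine Finset.sum_congr rfl fun j hj => ?_
      rw [hε' j (Finset.mem_filter.1 hj).2, mul_assoc, div_mul_cancel₀ _ (hω.ne_zero _), map_mul]
  have h1 := hε' i hi
  rw [((unique hω h h').2 i hi).2] at h1
  rw [map_pow, ← mul_one (σ _ ^ _), ← hroot i, ← mul_pow, ← h1]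

/-- The field is infinite over `ℚ_p` and need not be closed under arbitrary limits; but `x` is
algebraic, and a continuous `σ` fixing every partial sum fixes `x`. -/
theorem mem_adjoinTeichmuller (hω : IsPowerSystem p ω) (h : IsExpansion p ω x N t ε) {e : ℕ}
    (ht : ∀ i : ℕ, (i : ℕ∞) < N → ∃ j : ℤ, t i = j / e) :
    x ∈ adjoinTeichmuller ℚ_[p]⟮ω (1 / e)⟯ := by
  refine mem_of_forall_fixing fun σ hσ => ?_
  have h1 := ((continuous_algEquiv σ).tendsto x).comp h.tendsto_sum
  refine tendsto_nhds_unique h1 (h.tendsto_sum.congr fun m => ?_)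
  refine (hσ _ (sum_mem fun i hi => mul_mem ?_ ?_)).symm
  · exact (isTeichmullerRep_teichmuller _).mem_adjoinTeichmuller _
  · obtain ⟨j, hj⟩ := ht i (Finset.mem_filter.1 hi).2
    rw [hj, div_eq_mul_one_div (j : ℚ), hω.map_zsmul]
    exact zpow_mem (le_adjoinTeichmuller _
      (IntermediateField.mem_adjoin_simple_self ℚ_[p] (ω (1 / e)))) j

end IsExpansion

/-! ### Finiteness of the set of digits -/

/-- A finite extension of `ℚ_p` contains only finitely many Teichmüller representatives. -/
theorem finite_isTeichmullerRep (K : IntermediateField ℚ_[p] (PadicAlgCl p))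
    [FiniteDimensional ℚ_[p] K] : {z : PadicAlgCl p | z ∈ K ∧ IsTeichmullerRep z}.Finite := by
  have : ProperSpace K := FiniteDimensional.proper ℚ_[p] K
  -- The unit ball is compact, and a ball of radius `1/2` contains at most one Teichmüller
  -- representative.
  obtain ⟨s, hs, hcover⟩ := Metric.totallyBounded_iff.1
    (isCompact_closedBall (0 : K) 1).totallyBounded (1 / 2) (by norm_num)
  have hc : ∀ z : {z : PadicAlgCl p | z ∈ K ∧ IsTeichmullerRep z}, ∃ y : s,
      ‖(z : PadicAlgCl p) - ((y : K) : PadicAlgCl p)‖ < 1 / 2 := by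
    rintro ⟨z, hz, hzT⟩
    have h1 : (⟨z, hz⟩ : K) ∈ Metric.closedBall (0 : K) 1 := by
      rw [mem_closedBall_zero_iff]
      exact hzT.norm_le_one
    obtain ⟨y, hy, hyz⟩ := Set.mem_iUnion₂.1 (hcover h1)
    refine ⟨⟨y, hy⟩, ?_⟩
    rw [Metric.mem_ball, dist_eq_norm] at hyz
    exact hyz
  choose f hf using hc
  have : Finite s := hs
  refine Finite.of_injective f fun z w hzw => Subtype.ext ?_
  refine z.2.2.eq_of_norm_sub_lt_one w.2.2 ?_
  have hz := hf z
  have hw := hf w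
  rw [← hzw] at hw
  have := norm_sub_le_max ((z : PadicAlgCl p) - ((f z : K) : PadicAlgCl p))
    ((w : PadicAlgCl p) - ((f z : K) : PadicAlgCl p))
  rw [sub_sub_sub_cancel_right] at this
  exact this.trans_lt (max_lt (hz.trans (by norm_num)) (hw.trans (by norm_num)))

theorem charP_digit : CharP (Digit p) p := by
  obtain ⟨q, hq⟩ := CharP.exists (Digit p)
  have hdvd := (CharP.cast_eq_zero_iff (Digit p) q p).1 digit_natCast_p
  rcases (Nat.dvd_prime (Fact.out : p.Prime)).1 hdvd with rfl | rfl
  · exact absurd rfl (CharP.char_ne_one (Digit p) 1)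
  · exact hq

/-- The fixed field of a suitable power of Frobenius works: its elements are roots of `X ^ p ^ k -
X`. -/
theorem exists_finite_subfield {D : Set (Digit p)} (hD : D.Finite) :
    ∃ k : Subfield (Digit p), Finite k ∧ D ⊆ k := by
  classical
  have : CharP (Digit p) p := charP_digit
  obtain ⟨k, hk, h⟩ := exists_common_period (hD.toFinset.image teichmuller) (by
    intro z hz
    obtain ⟨a, -, rfl⟩ := Finset.mem_image.1 hz
    exact isTeichmullerRep_teichmuller a)
  have hq : 1 < p ^ k := Nat.one_lt_pow (by omega) (Fact.out : p.Prime).one_lt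
  refine ⟨(iterateFrobenius (Digit p) p k).eqLocusField (RingHom.id _), ?_, fun a ha => ?_⟩
  · have hne : (X ^ p ^ k - X : (Digit p)[X]) ≠ 0 := FiniteField.X_pow_card_sub_X_ne_zero _ hq
    refine Set.Finite.subset (rootSet_finite (X ^ p ^ k - X : (Digit p)[X]) (Digit p)) fun a ha => ?_
    rw [mem_rootSet_of_ne hne]
    have h1 : a ^ p ^ k = a := ha
    simp [h1]
  · change a ^ p ^ k = a
    have h1 := h (teichmuller a) (Finset.mem_image_of_mem _ (hD.mem_toFinset.2 ha))
    have h2 : (⟨teichmuller a, teichmuller_mem_intRing a⟩ : IntRing p) ^ p ^ k =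
      ⟨teichmuller a, teichmuller_mem_intRing a⟩ := Subtype.ext h1
    rw [← residue_teichmuller a, ← map_pow, h2]

theorem finite_setOf_teichmuller_pow_mem (K : IntermediateField ℚ_[p] (PadicAlgCl p))
    [FiniteDimensional ℚ_[p] K] {e : ℕ} (he : e ≠ 0) :
    {a : Digit p | teichmuller a ^ e ∈ K}.Finite := by
  have h1 : ((fun z : PadicAlgCl p => z ^ e) ⁻¹' {z | z ∈ K ∧ IsTeichmullerRep z}).Finite := by
    refine (finite_isTeichmullerRep K).preimage' fun c _ => ?_
    classical
    exact (nthRoots e c).toFinset.finite_toSet.subset fun z hz => by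
      rw [Finset.mem_coe, Multiset.mem_toFinset, mem_nthRoots (Nat.pos_of_ne_zero he)]
      exact hz
  refine (h1.preimage teichmuller_injective.injOn).subset fun a ha => ?_
  exact ⟨ha, (isTeichmullerRep_teichmuller a).pow e⟩

end PadicExpansion

/-! ### The theorem -/

open PadicExpansion in
theorem theorem6p1 (p : ℕ) [Fact p.Prime]
    (ω : ℚ → PadicAlgCl p) (hω : PadicExpansion.IsPowerSystem p ω)
    (x : PadicAlgCl p) (hx : Valued.v x ≤ 1) (hn : ¬ p ∣ (minpoly ℚ_[p] x).natDegree) :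
    ∃ (N : ℕ∞) (t : ℕ → ℚ) (ε : ℕ → PadicExpansion.Digit p),
      PadicExpansion.IsExpansion p ω x N t ε ∧
      Tendsto (fun m : ℕ => {i ∈ Finset.range m | ((i : ℕ) : ℕ∞) < N}.lcm fun i => (t i).den) atTop
        (𝓝 (PadicExpansion.ramificationIndex p ℚ_[p]⟮x⟯)) ∧
      (∀ i : ℕ, (i : ℕ∞) < N → PadicExpansion.teichmuller (ε i) ^ (t i).den ∈ ℚ_[p]⟮x⟯) ∧
      (∃ k : Subfield (PadicExpansion.Digit p), Finite k ∧ ∀ i : ℕ, (i : ℕ∞) < N → ε i ∈ k) ∧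
      (∀ (N' : ℕ∞) (t' : ℕ → ℚ) (ε' : ℕ → PadicExpansion.Digit p),
        PadicExpansion.IsExpansion p ω x N' t' ε' →
          N' = N ∧ ∀ i : ℕ, (i : ℕ∞) < N → t' i = t i ∧ ε' i = ε i) := by
  have hint : IsIntegral ℚ_[p] x := Algebra.IsIntegral.isIntegral _
  have : FiniteDimensional ℚ_[p] ℚ_[p]⟮x⟯ := IntermediateField.adjoin.finiteDimensional hint
  obtain ⟨e, he0, hen, hval, π, hπ, hπe⟩ := hω.exists_uniformizer ℚ_[p]⟮x⟯
  rw [IntermediateField.adjoin.finrank hint] at hen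
  have hpe : ¬ p ∣ e := fun h => hn (h.trans hen)
  have heQ : (e : ℚ) ≠ 0 := Nat.cast_ne_zero.2 he0
  have hxK := IntermediateField.mem_adjoin_simple_self ℚ_[p] x
  obtain ⟨N, t, ε, h, ht⟩ := hω.exists_isExpansion (L := adjoinTeichmuller ℚ_[p]⟮x⟯) he0
    (fun y hy hy0 => by
      obtain ⟨c, hc, hc0, hyc⟩ := exists_norm_eq_of_mem_adjoinTeichmuller hy hy0
      rw [hyc]
      exact hval c hc hc0)
    (hω.root_mem_adjoinTeichmuller hpe hπ hπe)
    (fun a => (isTeichmullerRep_teichmuller a).mem_adjoinTeichmuller _)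
    (le_adjoinTeichmuller _ hxK)
  have hden : ∀ i : ℕ, (i : ℕ∞) < N → (t i).den ∣ e := by
    intro i hi
    obtain ⟨j, hj⟩ := ht i hi
    have := Rat.den_dvd j e
    rw [hj]
    exact_mod_cast this
  have hmem : ∀ i : ℕ, (i : ℕ∞) < N → teichmuller (ε i) ^ (t i).den ∈ ℚ_[p]⟮x⟯ := fun i hi =>
    h.teichmuller_pow_den_mem hω (fun j hj hp => hpe (hp.trans (hden j hj))) hi
  refine ⟨N, t, ε, h, ?_, hmem, ?_, fun N' t' ε' h' => IsExpansion.unique hω h h'⟩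
  · rw [hω.ramificationIndex_eq he0 hval hπ hπe]
    set l : ℕ → ℕ := fun m => {i ∈ Finset.range m | ((i : ℕ) : ℕ∞) < N}.lcm fun i => (t i).den
      with hl
    have hle : ∀ m, l m ∣ e := fun m => Finset.lcm_dvd fun i hi => hden i (Finset.mem_filter.1 hi).2
    have hmono : ∀ {m m'}, m ≤ m' → l m ∣ l m' := fun hm =>
      Finset.lcm_mono (Finset.filter_subset_filter _ (Finset.range_mono hm))
    -- The lcms divide `e` and form a divisibility chain, so they are constant from an index `m₀`
    -- where the maximum is reached.
    obtain ⟨_, ⟨m₀, rfl⟩, hmax⟩ := Set.exists_max_image (Set.range l) id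
      ((Set.finite_Iic e).subset (Set.range_subset_iff.2 fun m =>
        Nat.le_of_dvd (Nat.pos_of_ne_zero he0) (hle m))) (Set.range_nonempty l)
    have hl0 : l m₀ ≠ 0 := ne_zero_of_dvd_ne_zero he0 (hle m₀)
    have hconst : ∀ m, m₀ ≤ m → l m = l m₀ := fun m hm =>
      (hmax _ ⟨m, rfl⟩).antisymm (Nat.le_of_dvd (Nat.pos_of_ne_zero
        (ne_zero_of_dvd_ne_zero he0 (hle m))) (hmono hm))
    have hdl : ∀ i : ℕ, (i : ℕ∞) < N → (t i).den ∣ l m₀ := by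
      intro i hi
      rw [← hconst (max m₀ (i + 1)) (le_max_left _ _)]
      exact Finset.dvd_lcm (Finset.mem_filter.2 ⟨Finset.mem_range.2 (by omega), hi⟩)
    have hle' : e ∣ l m₀ := by
      have hx' := h.mem_adjoinTeichmuller hω (e := l m₀) fun i hi => by
        obtain ⟨c, hc⟩ := hdl i hi
        refine ⟨(t i).num * c, ?_⟩
        have hc0 : (c : ℚ) ≠ 0 := Nat.cast_ne_zero.2 (by
          rintro rfl
          exact hl0 hc)
        rw [hc, Nat.cast_mul, Int.cast_mul, Int.cast_natCast, mul_div_mul_right _ _ hc0,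
          Rat.num_div_den]
      -- All of `ℚ_p(x)`, in particular its uniformizer, lies in this field. So the value `1/e` lies
      -- in `(1/l)ℤ` with `l = l m₀`, which gives `e ∣ l`.
      have hπ' : π ∈ adjoinTeichmuller ℚ_[p]⟮ω (1 / (l m₀ : ℕ))⟯ :=
        IntermediateField.adjoin_simple_le_iff.2 hx' hπ
      obtain ⟨c, hc, hc0, hπc⟩ := exists_norm_eq_of_mem_adjoinTeichmuller hπ'
        (norm_pos_iff.1 (hπe ▸ hω.norm_pos _))
      obtain ⟨i, hi⟩ := hω.exists_norm_eq_of_mem_adjoin hl0 hc hc0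
      have h1 := hω.eq_of_norm_eq (hπe.symm.trans (hπc.trans hi))
      rw [div_eq_div_iff heQ (Nat.cast_ne_zero.2 hl0), one_mul] at h1
      have h2 : (e : ℤ) ∣ l m₀ := ⟨i, by rw [mul_comm]; exact_mod_cast h1⟩
      exact_mod_cast h2
    refine tendsto_const_nhds.congr' (eventually_atTop.2 ⟨m₀, fun m hm => ?_⟩)
    rw [hconst m hm]
    exact Nat.dvd_antisymm hle' (hle m₀)
  -- The uniform exponent `e`, a multiple of every `v_i`, puts all the `[ε_i] ^ e` in `ℚ_p(x)`.
  · obtain ⟨k, hk, hD⟩ := exists_finite_subfield (finite_setOf_teichmuller_pow_mem ℚ_[p]⟮x⟯ he0)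
    refine ⟨k, hk, fun i hi => hD ?_⟩
    obtain ⟨c, hc⟩ := hden i hi
    rw [Set.mem_ofPred_eq, hc, pow_mul]
    exact pow_mem (hmem i hi) c
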